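/- For a complex $m\times n$ matrix $X$ ($m,n\in\mathbb N$) write: - $\|X\|_F$ for the operator norm of the map $F_X:(\mathbb C^n,\|\cdot\|_\infty)\to(\mathbb C^m,\|\cdot\|_2)$ with matrix $X$, and $\|X\|_{cbF}=\sup_{k}\|F_X\otimes \mathrm{id}_{M_k(\mathbb C)}\|$ for its completely bounded norm, where $(\mathbb C^n,\|\cdot\|_\infty)$ is the abelian C*-algebra of functions on $n$ points and $\mathbb C^m$ is the operator space $M_{(m,1)}(\mathbb C)$ of column matrices; - $\|X\|_S$ for the norm of the Schur multiplier $A\mapsto (X_{ij}A_{ij})_{i,j}$ on the $m\times n$ complex matrices with the operator norm; - $\|X\|_{\wedge(\infty,\infty)}=\inf\sum_l\|a_l\|_\infty\|b_l\|_\infty$ for the projective cross norm on $(\mathbb C^m,\|\cdot\|_\infty)\otimes(\mathbb C^n,\|\cdot\|_\infty)$, the infimum being over all finite families $a_l\in\mathbb C^m$, $b_l\in\mathbb C^n$ with $X_{ij}=\sum_l (a_l)_i(b_l)_j$ for all $i,j$. Let the little Grothendieck constant $k_G^{\mathbb C}$ be the smallest $c>0$ such that $\|X\|_{cbF}\le\sqrt{c}\,\|X\|_F$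 for all $m,n$ and all complex $m\times n$ matrices $X$, and let the Grothendieck constant $K_G^{\mathbb C}$ be the smallest $c>0$ such that $\|X\|_{\wedge(\infty,\infty)}\le c\,\|X\|_S$ for all $m,n$ and all complex $m\times n$ matrices $X$. **Theorem.** Both smallest constants exist, $k_G^{\mathbb C}<2$, and $$k_G^{\mathbb C}\;\le\;K_G^{\mathbb C}\;\le\;\frac{k_G^{\mathbb C}}{2-k_G^{\mathbb C}}.$$ -/

import Mathlib

namespace GrothendieckConstants

noncomputable section

open scoped Matrix Matrix.Norms.L2Operator

/-- The operator `F_X : (ℂⁿ, ‖·‖_∞) → (ℂᵐ, ‖·‖₂)` with matrix `X`. The domain `Fin n → ℂ`, with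
its sup norm, is the abelian C*-algebra `𝒜_n = C({1, …, n}, ℂ)`. -/
def opF {m n : ℕ} (X : Matrix (Fin m) (Fin n) ℂ) :
    (Fin n → ℂ) →L[ℂ] EuclideanSpace ℂ (Fin m) :=
  LinearMap.toContinuousLinearMap
    ((WithLp.linearEquiv 2 ℂ (Fin m → ℂ)).symm.toLinearMap ∘ₗ Matrix.mulVecLin X)

/-- `‖X‖_F`, the operator norm of `F_X`. -/
def normF {m n : ℕ} (X : Matrix (Fin m) (Fin n) ℂ) : ℝ := ‖opF X‖

/-- The `k`-th amplification `F_X ⊗ id : M_k(𝒜_n) → M_k(M_{(m,1)}(ℂ))` of `F_X`, where `ℂᵐ` is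
the space `M_{(m,1)}(ℂ)` of column matrices. Here `M_k(𝒜_n)` is identified with the C*-algebra
`M_k(ℂ)ⁿ`, whose norm is the maximum of the operator norms of the components, and
`M_k(M_{(m,1)}(ℂ))` with the `mk × k` matrices under the operator norm; matrices carry the
operator norm throughout this section. -/
def ampF {m n : ℕ} (X : Matrix (Fin m) (Fin n) ℂ) (k : ℕ) :
    (Fin n → Matrix (Fin k) (Fin k) ℂ) →L[ℂ] Matrix (Fin m × Fin k) (Fin k) ℂ :=
  LinearMap.toContinuousLinearMap
    { toFun := fun a => Matrix.of fun p t => ∑ j, X p.1 j * a j p.2 t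
      map_add' := fun a b => by
        ext p t
        simp [mul_add, Finset.sum_add_distrib]
      map_smul' := fun c a => by
        ext p t
        simp [Finset.mul_sum, mul_left_comm] }

/-- `‖X‖_{cbF}`, the completely bounded norm `sup_k ‖F_X ⊗ id_{M_k}‖` of `F_X`; the supremum is
finite by `bddAbove_norm_ampF`. -/
def normcbF {m n : ℕ} (X : Matrix (Fin m) (Fin n) ℂ) : ℝ := ⨆ k : ℕ, ‖ampF X k‖

/-- `‖X‖_S`, the norm of the Schur multiplier `A ↦ X ⊙ A` (entrywise product) on the `m × n`
matrices with the operator norm. -/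
def normS {m n : ℕ} (X : Matrix (Fin m) (Fin n) ℂ) : ℝ :=
  ‖(LinearMap.toContinuousLinearMap
      { toFun := fun A => Matrix.hadamard X A
        map_add' := fun A B => Matrix.hadamard_add X A B
        map_smul' := fun c A => Matrix.hadamard_smul X A c } :
    Matrix (Fin m) (Fin n) ℂ →L[ℂ] Matrix (Fin m) (Fin n) ℂ)‖

/-- `‖X‖_{∧(∞,∞)}`, the projective cross norm on `(ℂᵐ, ‖·‖_∞) ⊗ (ℂⁿ, ‖·‖_∞)`, transported to
matrices by sending `a ⊗ b` to the rank one matrix `(a_i b_j)`. -/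
def normProj {m n : ℕ} (X : Matrix (Fin m) (Fin n) ℂ) : ℝ :=
  sInf {r : ℝ | ∃ (N : ℕ) (a : Fin N → Fin m → ℂ) (b : Fin N → Fin n → ℂ),
    X = ∑ l, Matrix.vecMulVec (a l) (b l) ∧ r = ∑ l, ‖a l‖ * ‖b l‖}

/-- The constants that are valid in the complex little Grothendieck inequality. -/
def littleConstants : Set ℝ :=
  {c : ℝ | 0 < c ∧ ∀ (m n : ℕ) (X : Matrix (Fin m) (Fin n) ℂ), normcbF X ≤ √c * normF X}

/-- The constants that are valid in the complex Grothendieck inequality. -/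
def bigConstants : Set ℝ :=
  {c : ℝ | 0 < c ∧ ∀ (m n : ℕ) (X : Matrix (Fin m) (Fin n) ℂ), normProj X ≤ c * normS X}

/-- The little Grothendieck constant `k_G^ℂ`. -/
def littleKG : ℝ := sInf littleConstants

/-- The Grothendieck constant `K_G^ℂ`. -/
def bigKG : ℝ := sInf bigConstants

theorem norm_ampF_le {m n : ℕ} (X : Matrix (Fin m) (Fin n) ℂ) (k : ℕ) :
    ‖ampF X k‖ ≤ ∑ i, ∑ j, ‖X i j‖ := by
  refine ContinuousLinearMap.opNorm_le_bound _ (by positivity) fun a => ?_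
  let V : Fin m → Matrix (Fin m × Fin k) (Fin k) ℂ :=
    fun i => Matrix.of fun p t => if p = (i, t) then 1 else 0
  have hV : ∀ i, ‖V i‖ ≤ 1 := by
    intro i
    have h1 : (V i)ᴴ * V i = Matrix.diagonal (fun _ => (1 : ℂ)) := by
      ext s t
      simp only [V, Matrix.mul_apply, Matrix.conjTranspose_apply, Matrix.of_apply,
        Matrix.diagonal_apply]
      rw [Fintype.sum_prod_type,
        Finset.sum_eq_single i (fun i' _ h => by simp [Prod.ext_iff, h]) (by simp),
        Finset.sum_eq_single t (fun t' _ h => by simp [Prod.ext_iff, h]) (by simp)]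
      by_cases h : s = t
      · simp [h]
      · simp [Prod.ext_iff, h, Ne.symm h]
    have h2 : ‖V i‖ * ‖V i‖ ≤ 1 := by
      rw [← Matrix.l2_opNorm_conjTranspose_mul_self, h1, Matrix.l2_opNorm_diagonal]
      exact (pi_norm_le_iff_of_nonneg zero_le_one).2 fun _ => by simp
    nlinarith [norm_nonneg (V i)]
  have hrep : ampF X k a = ∑ i, ∑ j, X i j • (V i * a j) := by
    ext p t
    simp only [ampF, LinearMap.coe_toContinuousLinearMap', LinearMap.coe_mk, AddHom.coe_mk,
      Matrix.of_apply, Matrix.sum_apply, Matrix.smul_apply, Matrix.mul_apply, V, smul_eq_mul]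
    rw [Finset.sum_comm]
    refine Finset.sum_congr rfl fun j _ => ?_
    obtain ⟨i, s⟩ := p
    rw [Finset.sum_eq_single i (fun i' _ h => by simp [Prod.ext_iff, h.symm]) (by simp)]
    simp [Prod.ext_iff]
  rw [hrep, Finset.sum_mul]
  refine (norm_sum_le _ _).trans (Finset.sum_le_sum fun i _ => ?_)
  rw [Finset.sum_mul]
  refine (norm_sum_le _ _).trans (Finset.sum_le_sum fun j _ => ?_)
  rw [norm_smul]
  gcongr
  calc ‖V i * a j‖ ≤ ‖V i‖ * ‖a j‖ := Matrix.l2_opNorm_mul _ _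
    _ ≤ 1 * ‖a‖ := by
      gcongr
      · exact hV i
      · exact norm_le_pi_norm a j
    _ = ‖a‖ := one_mul _

theorem bddAbove_norm_ampF {m n : ℕ} (X : Matrix (Fin m) (Fin n) ℂ) :
    BddAbove (Set.range fun k : ℕ => ‖ampF X k‖) :=
  ⟨∑ i, ∑ j, ‖X i j‖, by rintro _ ⟨k, rfl⟩; exact norm_ampF_le X k⟩

end

end GrothendieckConstants

/-! ### Moments of real Gaussian combinations of complex vectors -/

namespace GrothendieckConstants
open MeasureTheory ProbabilityTheory Real
open scoped InnerProductSpace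

/-! By `mem_littleConstants_iff`, the little inequality is a statement about positive semidefinite
forms: passing from scalars of modulus at most one to vectors of a unit ball costs a factor `c`
(`LittleIneq`). A real Gaussian average shows that `c = π / 2 < 2` works (`littleIneq_pi_div_two`).

For the lower bound on `K_G`, the Gram matrix of vectors in a unit ball is a Schur contraction, so
it nearly decomposes into rank one matrices of total weight `K_G`; each rank one term costs at most
`‖X‖_F ^ 2` (`littleConstants_of_bigConstants`).

For the upper bound, let `K` be the supremum of the projective norm over `gramBlocks`. Two
separation arguments carry the proof. First, `fromBlocks_mem_closure` says that `X` is, up to a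
small error, an off-diagonal block of a positive semidefinite matrix with diagonal at most `‖X‖_S`,
so `‖X‖_∧ ≤ K ‖X‖_S`. Second, `LittleIneq.mem_closure` says that a positive semidefinite `W` with
unit diagonal is nearly `c Z - R`, where `Z` is a convex combination of matrices `z z*` with `‖z‖_∞
≤ 1` and `R` is positive semidefinite. Comparing diagonals, `R` has diagonal at most about `c - 1`,
hence its block has projective norm at most `(c - 1) K`. Thus `K ≤ c + (c - 1) K`; as `K` is finite
and `c < 2`, this gives `K ≤ c / (2 - c)`. -/

theorem integral_abs_gaussianReal_zero_one : ∫ x, |x| ∂(gaussianReal 0 1) = √(2 / π) := by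
  rw [integral_gaussianReal_eq_integral_smul one_ne_zero]
  have h : ∀ x : ℝ, gaussianPDFReal 0 1 x • |x|
      = (√(2 * π))⁻¹ * (|x| * rexp (-(1 / 2) * |x| ^ 2)) := by
    intro x
    simp only [gaussianPDFReal, sub_zero, NNReal.coe_one, mul_one, smul_eq_mul, sq_abs]
    ring_nf
  simp_rw [h]
  rw [integral_const_mul, integral_comp_abs (f := fun x => x * rexp (-(1 / 2) * x ^ 2))]
  have h2 := integral_rpow_mul_exp_neg_mul_rpow (p := 2) (q := 1) (b := 1/2) two_pos (by norm_num)
    (by norm_num)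
  norm_num at h2
  have h3 : ∫ x in Set.Ioi (0:ℝ), x * rexp (-(1 / 2) * x ^ 2) = 1 := by
    simpa only [neg_mul] using h2
  rw [h3]
  have : √(2 * π) ≠ 0 := by positivity
  rw [Real.sqrt_div' _ pi_pos.le, Real.sqrt_mul (by norm_num)]
  have h4 : √2 * √2 = 2 := Real.mul_self_sqrt (by norm_num)
  have : √π ≠ 0 := by positivity
  field_simp
  linarith

theorem map_inner_stdGaussian {k : ℕ} (a : EuclideanSpace ℝ (Fin k)) :
    (stdGaussian (EuclideanSpace ℝ (Fin k))).map (fun x => ⟪a, x⟫_ℝ)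
      = (gaussianReal 0 1).map (fun x => ‖a‖ * x) := by
  have h := IsGaussian.map_eq_gaussianReal (μ := stdGaussian (EuclideanSpace ℝ (Fin k)))
    (innerSL ℝ a)
  rw [integral_strongDual_stdGaussian, variance_dual_stdGaussian] at h
  rw [gaussianReal_map_const_mul]
  simp only [mul_zero, mul_one]
  refine Eq.trans h ?_
  congr 1
  ext
  simp

theorem integral_abs_inner_stdGaussian {k : ℕ} (a : EuclideanSpace ℝ (Fin k)) :
    ∫ x, |⟪a, x⟫_ℝ| ∂(stdGaussian (EuclideanSpace ℝ (Fin k))) = √(2 / π) * ‖a‖ := by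
  have h := integral_map (μ := stdGaussian (EuclideanSpace ℝ (Fin k)))
    (φ := fun x => ⟪a, x⟫_ℝ) (by fun_prop) (f := fun y => |y|)
    (by fun_prop)
  rw [← h, map_inner_stdGaussian, integral_map (by fun_prop) (by fun_prop)]
  simp_rw [abs_mul, abs_norm]
  rw [integral_const_mul, integral_abs_gaussianReal_zero_one, mul_comm]

theorem memLp_inner_stdGaussian {k : ℕ} (a : EuclideanSpace ℝ (Fin k)) :
    MemLp (fun x => ⟪a, x⟫_ℝ) 2 (stdGaussian (EuclideanSpace ℝ (Fin k))) :=
  IsGaussian.memLp_dual _ (innerSL ℝ a) 2 (by norm_num)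

theorem integral_sq_inner_stdGaussian {k : ℕ} (a : EuclideanSpace ℝ (Fin k)) :
    ∫ x, ⟪a, x⟫_ℝ ^ 2 ∂(stdGaussian (EuclideanSpace ℝ (Fin k))) = ‖a‖ ^ 2 := by
  have h := variance_dual_stdGaussian (innerSL ℝ a)
  rw [variance_of_integral_eq_zero (by fun_prop) (integral_strongDual_stdGaussian _)] at h
  simpa using h

/-- The complex random variable `∑ xₛ yₛ`. -/
noncomputable def gaussSum {k : ℕ} (x : EuclideanSpace ℝ (Fin k)) (y : EuclideanSpace ℂ (Fin k)) :
    ℂ := ∑ s, (x s : ℂ) * y s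

noncomputable def rePart {k : ℕ} (y : EuclideanSpace ℂ (Fin k)) : EuclideanSpace ℝ (Fin k) :=
  WithLp.toLp 2 fun s => (y s).re

noncomputable def imPart {k : ℕ} (y : EuclideanSpace ℂ (Fin k)) : EuclideanSpace ℝ (Fin k) :=
  WithLp.toLp 2 fun s => (y s).im

variable {k : ℕ}

theorem norm_sq_eq_rePart_imPart (y : EuclideanSpace ℂ (Fin k)) :
    ‖y‖ ^ 2 = ‖rePart y‖ ^ 2 + ‖imPart y‖ ^ 2 := by
  simp only [EuclideanSpace.norm_sq_eq, rePart, imPart, Complex.sq_norm, Complex.normSq_apply,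
    ← Finset.sum_add_distrib, Real.norm_eq_abs, sq_abs]
  exact Finset.sum_congr rfl fun _ _ => by ring

theorem gaussSum_re (x : EuclideanSpace ℝ (Fin k)) (y : EuclideanSpace ℂ (Fin k)) :
    (gaussSum x y).re = ⟪rePart y, x⟫_ℝ := by
  simp [gaussSum, PiLp.inner_apply, rePart]

theorem gaussSum_im (x : EuclideanSpace ℝ (Fin k)) (y : EuclideanSpace ℂ (Fin k)) :
    (gaussSum x y).im = ⟪imPart y, x⟫_ℝ := by
  simp [gaussSum, PiLp.inner_apply, imPart]

theorem norm_gaussSum_sq (x : EuclideanSpace ℝ (Fin k)) (y : EuclideanSpace ℂ (Fin k)) :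
    ‖gaussSum x y‖ ^ 2 = ⟪rePart y, x⟫_ℝ ^ 2 + ⟪imPart y, x⟫_ℝ ^ 2 := by
  rw [Complex.sq_norm, Complex.normSq_apply, gaussSum_re, gaussSum_im]; ring

theorem integrable_norm_gaussSum_sq (y : EuclideanSpace ℂ (Fin k)) :
    Integrable (fun x => ‖gaussSum x y‖ ^ 2) (stdGaussian (EuclideanSpace ℝ (Fin k))) := by
  simp_rw [norm_gaussSum_sq]
  exact (memLp_inner_stdGaussian _).integrable_sq.add (memLp_inner_stdGaussian _).integrable_sq

theorem integral_norm_gaussSum_sq (y : EuclideanSpace ℂ (Fin k)) :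
    ∫ x, ‖gaussSum x y‖ ^ 2 ∂(stdGaussian (EuclideanSpace ℝ (Fin k))) = ‖y‖ ^ 2 := by
  simp_rw [norm_gaussSum_sq]
  rw [integral_add (memLp_inner_stdGaussian _).integrable_sq
    (memLp_inner_stdGaussian _).integrable_sq, integral_sq_inner_stdGaussian,
    integral_sq_inner_stdGaussian, norm_sq_eq_rePart_imPart]

theorem continuous_gaussSum (y : EuclideanSpace ℂ (Fin k)) : Continuous fun x => gaussSum x y := by
  unfold gaussSum; fun_prop

theorem integrable_norm_gaussSum (y : EuclideanSpace ℂ (Fin k)) :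
    Integrable (fun x => ‖gaussSum x y‖) (stdGaussian (EuclideanSpace ℝ (Fin k))) := by
  refine ((integrable_const (1 : ℝ)).add (integrable_norm_gaussSum_sq y)).mono'
    (continuous_gaussSum y).norm.aestronglyMeasurable (Filter.Eventually.of_forall fun x => ?_)
  simp only [norm_norm, Pi.add_apply]
  nlinarith [sq_nonneg (‖gaussSum x y‖ - 1)]

/-- The modulus is bounded below pointwise by its real and imaginary parts with weights `‖rePart y‖
/ ‖y‖` and `‖imPart y‖ / ‖y‖`, so the two real first moments add up to `‖y‖` exactly and no
independence is needed. -/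
theorem le_integral_norm_gaussSum (y : EuclideanSpace ℂ (Fin k)) :
    √(2 / π) * ‖y‖ ≤ ∫ x, ‖gaussSum x y‖ ∂(stdGaussian (EuclideanSpace ℝ (Fin k))) := by
  rcases (norm_nonneg y).eq_or_lt with h0 | h0
  · rw [← h0, mul_zero]; exact integral_nonneg fun _ => norm_nonneg _
  have hi : ∀ a : EuclideanSpace ℝ (Fin k), Integrable (fun x => |⟪a, x⟫_ℝ|)
      (stdGaussian (EuclideanSpace ℝ (Fin k))) := fun a =>
    ((memLp_inner_stdGaussian a).integrable (by norm_num)).abs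
  have key : ∫ x, (‖rePart y‖ * |⟪rePart y, x⟫_ℝ| + ‖imPart y‖ * |⟪imPart y, x⟫_ℝ|)
      ∂(stdGaussian (EuclideanSpace ℝ (Fin k))) ≤
      ∫ x, ‖y‖ * ‖gaussSum x y‖ ∂(stdGaussian (EuclideanSpace ℝ (Fin k))) := by
    refine integral_mono (((hi _).const_mul _).add ((hi _).const_mul _))
      ((integrable_norm_gaussSum y).const_mul _) fun x => ?_
    -- Cauchy–Schwarz in the plane, in squared form.
    refine abs_le_of_sq_le_sq' ?_ (by positivity) |>.2
    have h1 := norm_gaussSum_sq x y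
    rw [mul_pow, h1, norm_sq_eq_rePart_imPart, ← sq_abs ⟪rePart y, x⟫_ℝ,
      ← sq_abs ⟪imPart y, x⟫_ℝ]
    nlinarith [sq_nonneg (‖rePart y‖ * |⟪imPart y, x⟫_ℝ| - ‖imPart y‖ * |⟪rePart y, x⟫_ℝ|)]
  rw [integral_add ((hi _).const_mul _) ((hi _).const_mul _), integral_const_mul,
    integral_const_mul, integral_const_mul, integral_abs_inner_stdGaussian,
    integral_abs_inner_stdGaussian] at key
  have h2 := norm_sq_eq_rePart_imPart y
  refine le_of_mul_le_mul_left ?_ h0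
  calc ‖y‖ * (√(2 / π) * ‖y‖) = √(2 / π) * ‖y‖ ^ 2 := by ring
    _ = ‖rePart y‖ * (√(2 / π) * ‖rePart y‖) + ‖imPart y‖ * (√(2 / π) * ‖imPart y‖) := by
      rw [h2]; ring
    _ ≤ _ := key

theorem gaussSum_sum {ι : Type*} [Fintype ι] (x : EuclideanSpace ℝ (Fin k)) (a : ι → ℂ)
    (y : ι → EuclideanSpace ℂ (Fin k)) :
    gaussSum x (∑ i, a i • y i) = ∑ i, a i * gaussSum x (y i) := by
  simp only [gaussSum, WithLp.ofLp_sum, WithLp.ofLp_smul, Finset.sum_apply, Pi.smul_apply,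
    smul_eq_mul, Finset.mul_sum]
  rw [Finset.sum_comm]
  exact Finset.sum_congr rfl fun _ _ => Finset.sum_congr rfl fun _ _ => by ring

end GrothendieckConstants

/-! ### The little inequality with constant π/2 -/

namespace GrothendieckConstants
open MeasureTheory ProbabilityTheory Real
open scoped InnerProductSpace

/-- The vector form of the little Grothendieck inequality with constant `c`: a positive
semidefinite form bounded by `B` on scalar families of sup norm at most one is bounded by `c * B`
on families from the unit ball of a Hilbert space. -/
def LittleIneq (c : ℝ) : Prop :=
  ∀ (κ ι : Type) [Fintype κ] [Fintype ι] (X : Matrix κ ι ℂ) (B : ℝ),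
    (∀ z : ι → ℂ, (∀ j, ‖z j‖ ≤ 1) → ∑ i, ‖∑ j, X i j * z j‖ ^ 2 ≤ B) →
    ∀ (k : ℕ) (u : ι → EuclideanSpace ℂ (Fin k)), (∀ j, ‖u j‖ ≤ 1) →
      ∑ i, ‖∑ j, X i j • u j‖ ^ 2 ≤ c * B

/-- The left side is the `ℓ¹` norm of the adjoint applied to `y`. Testing against unimodular phases
moves the operator back to the scalar side, and a weighted AM–GM with parameter `t` keeps the bound
quadratic in `y`, so that it can be integrated. -/
theorem sum_norm_le_of_scalar_bound {κ ι : Type*} [Fintype κ] [Fintype ι] (X : Matrix κ ι ℂ)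
    {B : ℝ} (hB : ∀ z : ι → ℂ, (∀ j, ‖z j‖ ≤ 1) → ∑ i, ‖∑ j, X i j * z j‖ ^ 2 ≤ B)
    (y : κ → ℂ) {t : ℝ} (ht : 0 < t) :
    ∑ j, ‖∑ i, star (X i j) * y i‖ ≤ (∑ i, ‖y i‖ ^ 2 / t + t * B) / 2 := by
  have hz : ∀ w : ℂ, ∃ z : ℂ, ‖z‖ ≤ 1 ∧ star w * z = ‖w‖ := by
    intro w
    by_cases hw : w = 0
    · exact ⟨0, by simp, by simp [hw]⟩
    · refine ⟨w / ‖w‖, by simp [hw], ?_⟩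
      have : (‖w‖ : ℂ) ≠ 0 := by simpa using hw
      rw [mul_div_assoc', Complex.star_def, Complex.conj_mul']
      field_simp
  choose z hz1 hz2 using hz
  set v : ι → ℂ := fun j => z (∑ i, star (X i j) * y i) with hv
  have h1 : ((∑ j, ‖∑ i, star (X i j) * y i‖ : ℝ) : ℂ) = ∑ i, star (y i) * ∑ j, X i j * v j := by
    push_cast
    simp_rw [← hz2, Finset.mul_sum, star_sum, Finset.sum_mul]
    rw [Finset.sum_comm]
    refine Finset.sum_congr rfl fun i _ => Finset.sum_congr rfl fun j _ => ?_
    simp only [star_mul', star_star, hv]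
    ring
  have h2 : ∑ j, ‖∑ i, star (X i j) * y i‖ ≤ ∑ i, ‖y i‖ * ‖∑ j, X i j * v j‖ := by
    have h3 := congrArg norm h1
    rw [Complex.norm_real, Real.norm_of_nonneg (by positivity)] at h3
    rw [h3]
    refine (norm_sum_le _ _).trans_eq ?_
    simp
  have h4 := hB v fun j => hz1 _
  refine h2.trans ?_
  calc ∑ i, ‖y i‖ * ‖∑ j, X i j * v j‖
      ≤ ∑ i, (‖y i‖ ^ 2 / t + t * ‖∑ j, X i j * v j‖ ^ 2) / 2 := by
        refine Finset.sum_le_sum fun i _ => ?_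
        rw [le_div_iff₀ two_pos, div_add' _ _ _ ht.ne', le_div_iff₀ ht]
        nlinarith [sq_nonneg (‖y i‖ - t * ‖∑ j, X i j * v j‖)]
    _ = (∑ i, ‖y i‖ ^ 2 / t + t * ∑ i, ‖∑ j, X i j * v j‖ ^ 2) / 2 := by
        rw [← Finset.sum_div, Finset.sum_add_distrib, Finset.mul_sum]
    _ ≤ _ := by gcongr

theorem littleIneq_pi_div_two : LittleIneq (π / 2) := by
  intro κ ι _ _ X B hB k u hu
  set b := √(2 / π) with hb
  have hb0 : 0 < b := by positivity
  set y : κ → EuclideanSpace ℂ (Fin k) := fun i => ∑ j, X i j • u j with hy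
  set w : ι → EuclideanSpace ℂ (Fin k) := fun j => ∑ i, star (X i j) • y i with hw
  set μ := stdGaussian (EuclideanSpace ℝ (Fin k))
  set V := ∑ i, ‖y i‖ ^ 2 with hV
  -- Moving `X` to its adjoint gives `V = ∑ ⟪w j, u j⟫`, with every `u j` in the unit ball.
  have h1 : V ≤ ∑ j, ‖w j‖ := by
    have h2 : (V : ℂ) = ∑ j, ⟪w j, u j⟫_ℂ := by
      rw [hV]
      push_cast
      have : ∀ i, (‖y i‖ : ℂ) ^ 2 = ∑ j, X i j * ⟪y i, u j⟫_ℂ := by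
        intro i
        have := inner_self_eq_norm_sq_to_K (𝕜 := ℂ) (y i)
        simp only [Complex.coe_algebraMap] at this
        rw [← this]
        nth_rw 2 [show y i = ∑ j, X i j • u j from rfl]
        simp only [inner_sum, inner_smul_right]
      simp_rw [this]
      rw [Finset.sum_comm]
      refine Finset.sum_congr rfl fun j _ => ?_
      simp [hw, mul_comm]
    have h3 := congrArg norm h2
    rw [Complex.norm_real, Real.norm_of_nonneg (by positivity)] at h3
    rw [h3]
    refine (norm_sum_le _ _).trans (Finset.sum_le_sum fun j _ => (norm_inner_le_norm _ _).trans ?_)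
    exact mul_le_of_le_one_right (norm_nonneg _) (hu j)
  -- The scalar bound at each sample point, with the optimal weight `t = b⁻¹`; after integration
  -- half of `b * V` is absorbed on the left.
  have h2 : ∑ j, ∫ x, ‖gaussSum x (w j)‖ ∂μ ≤ (∑ i, ‖y i‖ ^ 2 / b⁻¹ + b⁻¹ * B) / 2 := by
    rw [← integral_finsetSum _ fun j _ => integrable_norm_gaussSum _]
    have hi : Integrable (fun x => ∑ i, ‖gaussSum x (y i)‖ ^ 2 / b⁻¹) μ :=
      integrable_finsetSum _ fun i _ => (integrable_norm_gaussSum_sq _).div_const _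
    calc _ ≤ ∫ x, (∑ i, ‖gaussSum x (y i)‖ ^ 2 / b⁻¹ + b⁻¹ * B) / 2 ∂μ := by
          refine integral_mono (integrable_finsetSum _ fun i _ => integrable_norm_gaussSum _)
            ((hi.add (integrable_const _)).div_const _) fun x => ?_
          simp only [hw, gaussSum_sum]
          exact sum_norm_le_of_scalar_bound X hB _ (by positivity)
      _ = _ := by
          rw [integral_div, integral_add hi (integrable_const _), integral_finsetSum _ fun i _ =>
            (integrable_norm_gaussSum_sq _).div_const _]
          simp only [integral_div, μ, integral_norm_gaussSum_sq, integral_const, probReal_univ,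
            one_smul]
  have h3 : b * ∑ j, ‖w j‖ ≤ ∑ j, ∫ x, ‖gaussSum x (w j)‖ ∂μ := by
    rw [Finset.mul_sum]
    exact Finset.sum_le_sum fun j _ => le_integral_norm_gaussSum _
  have h4 : b * V ≤ (V * b + b⁻¹ * B) / 2 := by
    refine (mul_le_mul_of_nonneg_left h1 hb0.le).trans (h3.trans (h2.trans_eq ?_))
    rw [← Finset.sum_div, div_inv_eq_mul]
  have h5 : b * V ≤ b⁻¹ * B := by linarith
  have h6 : b ^ 2 = 2 / π := Real.sq_sqrt (by positivity)
  have h7 : V ≤ (b ^ 2)⁻¹ * B := by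
    rw [← mul_le_mul_iff_of_pos_left hb0]
    refine h5.trans_eq ?_
    field_simp
  rwa [h6, inv_div] at h7

end GrothendieckConstants

/-! ### The completely bounded norm as a supremum over vectors -/

namespace GrothendieckConstants
open scoped Matrix Matrix.Norms.L2Operator

theorem l2_opNorm_le_of_unit {m n : Type*} [Fintype m] [Fintype n] [DecidableEq n]
    (A : Matrix m n ℂ) {C : ℝ} (hC : 0 ≤ C)
    (h : ∀ x : EuclideanSpace ℂ n, ‖x‖ = 1 → ∑ i, ‖∑ j, A i j * x j‖ ^ 2 ≤ C ^ 2) : ‖A‖ ≤ C := by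
  rw [Matrix.l2_opNorm_def]
  refine ContinuousLinearMap.opNorm_le_of_unit_norm hC fun x hx => ?_
  refine abs_le_of_sq_le_sq' ?_ hC |>.2
  rw [EuclideanSpace.norm_sq_eq]
  exact h x hx

theorem sum_norm_sq_le_l2_opNorm {m n : Type*} [Fintype m] [Fintype n] [DecidableEq n]
    (A : Matrix m n ℂ) (x : EuclideanSpace ℂ n) :
    ∑ i, ‖∑ j, A i j * x j‖ ^ 2 ≤ (‖A‖ * ‖x‖) ^ 2 := by
  have h := Matrix.l2_opNorm_mulVec A x
  refine le_trans (le_of_eq ?_) (pow_le_pow_left₀ (norm_nonneg _) h 2)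
  rw [EuclideanSpace.norm_sq_eq]
  rfl

theorem norm_opF_sq {m n : ℕ} (X : Matrix (Fin m) (Fin n) ℂ) (z : Fin n → ℂ) :
    ‖opF X z‖ ^ 2 = ∑ i, ‖∑ j, X i j * z j‖ ^ 2 := by
  rw [EuclideanSpace.norm_sq_eq]; rfl

theorem normF_nonneg {m n : ℕ} (X : Matrix (Fin m) (Fin n) ℂ) : 0 ≤ normF X := norm_nonneg _

theorem sum_norm_sq_le_normF {m n : ℕ} (X : Matrix (Fin m) (Fin n) ℂ) (z : Fin n → ℂ) :
    ∑ i, ‖∑ j, X i j * z j‖ ^ 2 ≤ (normF X * ‖z‖) ^ 2 := by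
  rw [← norm_opF_sq]
  exact pow_le_pow_left₀ (norm_nonneg _) ((opF X).le_opNorm z) 2

theorem normF_sq_le {m n : ℕ} (X : Matrix (Fin m) (Fin n) ℂ) {B : ℝ}
    (hB : ∀ z : Fin n → ℂ, (∀ j, ‖z j‖ ≤ 1) → ∑ i, ‖∑ j, X i j * z j‖ ^ 2 ≤ B) :
    normF X ^ 2 ≤ B := by
  have hB0 : 0 ≤ B := (by positivity : (0:ℝ) ≤ _).trans (hB 0 (by simp))
  have : normF X ≤ √B := by
    refine ContinuousLinearMap.opNorm_le_of_unit_norm (Real.sqrt_nonneg _) fun z hz => ?_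
    refine Real.le_sqrt_of_sq_le ?_
    rw [norm_opF_sq]
    exact hB z fun j => (norm_le_pi_norm z j).trans hz.le
  calc normF X ^ 2 ≤ √B ^ 2 := pow_le_pow_left₀ (normF_nonneg X) this 2
    _ = B := Real.sq_sqrt hB0

theorem ampF_apply {m n : ℕ} (X : Matrix (Fin m) (Fin n) ℂ) (k : ℕ)
    (a : Fin n → Matrix (Fin k) (Fin k) ℂ) (p : Fin m × Fin k) (t : Fin k) :
    ampF X k a p t = ∑ j, X p.1 j * a j p.2 t := rfl

theorem sum_norm_ampF_mulVec {m n : ℕ} (X : Matrix (Fin m) (Fin n) ℂ) (k : ℕ)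
    (a : Fin n → Matrix (Fin k) (Fin k) ℂ) (x : EuclideanSpace ℂ (Fin k)) :
    ∑ p, ‖∑ t, ampF X k a p t * x t‖ ^ 2 =
      ∑ i, ‖∑ j, X i j • (WithLp.toLp 2 (a j *ᵥ x) : EuclideanSpace ℂ (Fin k))‖ ^ 2 := by
  rw [Fintype.sum_prod_type]
  refine Finset.sum_congr rfl fun i _ => ?_
  rw [EuclideanSpace.norm_sq_eq]
  refine Finset.sum_congr rfl fun s _ => ?_
  congr 2
  simp only [ampF_apply, WithLp.ofLp_sum, WithLp.ofLp_smul, Finset.sum_apply, Pi.smul_apply,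
    smul_eq_mul, Matrix.mulVec, dotProduct, Finset.mul_sum, Finset.sum_mul]
  rw [Finset.sum_comm]
  exact Finset.sum_congr rfl fun _ _ => Finset.sum_congr rfl fun _ _ => by ring

/-- Applied to a unit vector `x`, an amplification sees its matrices `a j` only through the vectors
`a j *ᵥ x`, which lie in the unit ball. -/
theorem normcbF_le_of_vector_bound {c : ℝ} (hc0 : 0 ≤ c) {m n : ℕ} (X : Matrix (Fin m) (Fin n) ℂ)
    (h : ∀ (k : ℕ) (u : Fin n → EuclideanSpace ℂ (Fin k)), (∀ j, ‖u j‖ ≤ 1) →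
      ∑ i, ‖∑ j, X i j • u j‖ ^ 2 ≤ c * normF X ^ 2) : normcbF X ≤ √c * normF X := by
  have hpos : 0 ≤ √c * normF X := mul_nonneg (Real.sqrt_nonneg _) (normF_nonneg X)
  refine ciSup_le fun k => ContinuousLinearMap.opNorm_le_of_unit_norm hpos fun a ha => ?_
  refine l2_opNorm_le_of_unit _ hpos fun x hx => ?_
  rw [sum_norm_ampF_mulVec, mul_pow, Real.sq_sqrt hc0]
  refine h k _ fun j => ?_
  refine (Matrix.l2_opNorm_mulVec (a j) x).trans ?_
  rw [hx, mul_one, ← ha]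
  exact norm_le_pi_norm a j

theorem LittleIneq.normcbF_le {c : ℝ} (hc0 : 0 ≤ c) (hc : LittleIneq c) {m n : ℕ}
    (X : Matrix (Fin m) (Fin n) ℂ) : normcbF X ≤ √c * normF X := by
  refine normcbF_le_of_vector_bound hc0 X fun k u hu => hc _ _ X _ (fun z hz => ?_) k u hu
  refine (sum_norm_sq_le_normF X z).trans
    (pow_le_pow_left₀ (mul_nonneg (normF_nonneg X) (norm_nonneg _)) ?_ 2)
  exact mul_le_of_le_one_right (normF_nonneg X) ((pi_norm_le_iff_of_nonneg zero_le_one).2 hz)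

/-- The vectors `u j` are realised as the first columns of rank one contractions, which are
evaluated at the first basis vector. -/
theorem sum_norm_sq_le_normcbF {m n : ℕ} (X : Matrix (Fin m) (Fin n) ℂ) (k : ℕ)
    (u : Fin n → EuclideanSpace ℂ (Fin k)) (hu : ∀ j, ‖u j‖ ≤ 1) :
    ∑ i, ‖∑ j, X i j • u j‖ ^ 2 ≤ normcbF X ^ 2 := by
  -- A first basis vector exists only for positive dimension; in dimension zero every term vanishes.
  rcases k with _ | k
  · simp only [Subsingleton.elim (α := EuclideanSpace ℂ (Fin 0)) _ 0, norm_zero]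
    simp [sq_nonneg]
  set a : Fin n → Matrix (Fin (k + 1)) (Fin (k + 1)) ℂ :=
    fun j => Matrix.vecMulVec (u j) (Pi.single 0 1) with ha
  have hax : ∀ (j) (x : EuclideanSpace ℂ (Fin (k + 1))),
      (WithLp.toLp 2 (a j *ᵥ x) : EuclideanSpace ℂ (Fin (k + 1))) = x 0 • u j := by
    intro j x
    ext s
    simp [ha, Matrix.vecMulVec_mulVec, mul_comm]
  have ha1 : ‖a‖ ≤ 1 := by
    refine (pi_norm_le_iff_of_nonneg zero_le_one).2 fun j => ?_
    refine l2_opNorm_le_of_unit _ zero_le_one fun x hx => ?_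
    have h1 : ‖x 0 • u j‖ ≤ 1 := by
      rw [norm_smul]
      refine mul_le_one₀ ?_ (norm_nonneg _) (hu j)
      exact (PiLp.norm_apply_le x 0).trans hx.le
    have h2 := pow_le_pow_left₀ (norm_nonneg _) h1 2
    rwa [← hax, EuclideanSpace.norm_sq_eq] at h2
  have h := sum_norm_sq_le_l2_opNorm (ampF X (k + 1) a) (EuclideanSpace.single 0 1)
  rw [sum_norm_ampF_mulVec] at h
  simp only [hax] at h
  simp only [PiLp.single_apply, if_true, one_smul] at h
  refine h.trans (pow_le_pow_left₀ (by positivity) ?_ 2)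
  rw [PiLp.norm_single, norm_one, mul_one]
  calc ‖ampF X (k + 1) a‖ ≤ ‖ampF X (k + 1)‖ * ‖a‖ := (ampF X (k + 1)).le_opNorm a
    _ ≤ ‖ampF X (k + 1)‖ := mul_le_of_le_one_right (ContinuousLinearMap.opNorm_nonneg _) ha1
    _ ≤ normcbF X := le_ciSup (bddAbove_norm_ampF X) (k + 1)

theorem normcbF_nonneg {m n : ℕ} (X : Matrix (Fin m) (Fin n) ℂ) : 0 ≤ normcbF X :=
  Real.iSup_nonneg fun _ => ContinuousLinearMap.opNorm_nonneg _

theorem littleIneq_of_mem {c : ℝ} (hc : c ∈ littleConstants) : LittleIneq c := by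
  intro κ ι _ _ X B hB k u hu
  let e := Fintype.equivFin ι
  let e' := Fintype.equivFin κ
  have hB' : normF (X.submatrix e'.symm e.symm) ^ 2 ≤ B := by
    refine normF_sq_le _ fun z hz => ?_
    refine le_trans (le_of_eq ?_) (hB (z ∘ e) fun j => hz _)
    rw [← e'.symm.sum_comp]
    refine Finset.sum_congr rfl fun i _ => ?_
    rw [← e.symm.sum_comp]
    simp
  have h := sum_norm_sq_le_normcbF (X.submatrix e'.symm e.symm) k (u ∘ e.symm) fun j => hu _
  have h2 := pow_le_pow_left₀ (normcbF_nonneg _) (hc.2 _ _ (X.submatrix e'.symm e.symm)) 2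
  rw [mul_pow, Real.sq_sqrt hc.1.le] at h2
  refine le_trans (le_of_eq ?_) (h.trans (h2.trans (mul_le_mul_of_nonneg_left hB' hc.1.le)))
  rw [← e'.symm.sum_comp]
  refine Finset.sum_congr rfl fun i _ => ?_
  rw [← e.symm.sum_comp]
  simp

theorem mem_littleConstants_iff {c : ℝ} : c ∈ littleConstants ↔ 0 < c ∧ LittleIneq c :=
  ⟨fun h => ⟨h.1, littleIneq_of_mem h⟩, fun h => ⟨h.1, fun _ _ X => h.2.normcbF_le h.1.le X⟩⟩

end GrothendieckConstants

/-! ### The projective norm -/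

namespace GrothendieckConstants
open scoped Matrix Matrix.Norms.L2Operator

section Projective

variable {m n : ℕ}

theorem normProj_le {ι : Type*} [Fintype ι] {X : Matrix (Fin m) (Fin n) ℂ}
    (a : ι → Fin m → ℂ) (b : ι → Fin n → ℂ) (h : X = ∑ l, Matrix.vecMulVec (a l) (b l)) :
    normProj X ≤ ∑ l, ‖a l‖ * ‖b l‖ := by
  refine csInf_le ⟨0, ?_⟩ ?_
  · rintro r ⟨N, a, b, -, rfl⟩
    positivity
  · let e := Fintype.equivFin ι
    refine ⟨_, a ∘ e.symm, b ∘ e.symm, ?_, ?_⟩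
    · rw [h, ← e.symm.sum_comp]; rfl
    · rw [← e.symm.sum_comp]; rfl

theorem exists_rep_lt (X : Matrix (Fin m) (Fin n) ℂ) {r : ℝ} (hr : normProj X < r) :
    ∃ (N : ℕ) (a : Fin N → Fin m → ℂ) (b : Fin N → Fin n → ℂ),
      X = ∑ l, Matrix.vecMulVec (a l) (b l) ∧ ∑ l, ‖a l‖ * ‖b l‖ < r := by
  have hne : {r : ℝ | ∃ (N : ℕ) (a : Fin N → Fin m → ℂ) (b : Fin N → Fin n → ℂ),
      X = ∑ l, Matrix.vecMulVec (a l) (b l) ∧ r = ∑ l, ‖a l‖ * ‖b l‖}.Nonempty := by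
    let e := (Fintype.equivFin (Fin m)).symm
    refine ⟨_, _, fun l => Pi.single (e l) 1, fun l => X (e l), ?_, rfl⟩
    rw [e.sum_comp fun i => Matrix.vecMulVec (Pi.single i 1) (X i)]
    ext i j
    simp [Matrix.sum_apply, Matrix.vecMulVec_apply, Pi.single_apply]
  obtain ⟨s, ⟨N, a, b, h, rfl⟩, hs⟩ := exists_lt_of_csInf_lt hne hr
  exact ⟨N, a, b, h, hs⟩

theorem normProj_nonneg (X : Matrix (Fin m) (Fin n) ℂ) : 0 ≤ normProj X := by
  refine Real.sInf_nonneg ?_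
  rintro r ⟨N, a, b, -, rfl⟩
  positivity

theorem normProj_vecMulVec_le (a : Fin m → ℂ) (b : Fin n → ℂ) :
    normProj (Matrix.vecMulVec a b) ≤ ‖a‖ * ‖b‖ := by
  simpa using normProj_le (ι := Unit) (fun _ => a) (fun _ => b) (by simp)

theorem normProj_add_le (X Y : Matrix (Fin m) (Fin n) ℂ) :
    normProj (X + Y) ≤ normProj X + normProj Y := by
  refine le_of_forall_pos_lt_add fun ε hε => ?_
  obtain ⟨N, a, b, h, hl⟩ := exists_rep_lt X (lt_add_of_pos_right (normProj X) (half_pos hε))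
  obtain ⟨N', a', b', h', hl'⟩ := exists_rep_lt Y (lt_add_of_pos_right (normProj Y) (half_pos hε))
  have := normProj_le (X := X + Y) (Sum.elim a a') (Sum.elim b b')
    (by rw [Fintype.sum_sum_type, h, h']; rfl)
  rw [Fintype.sum_sum_type] at this
  simp only [Sum.elim_inl, Sum.elim_inr] at this
  linarith

theorem normProj_smul_le (c : ℂ) (X : Matrix (Fin m) (Fin n) ℂ) :
    normProj (c • X) ≤ ‖c‖ * normProj X := by
  refine le_of_forall_pos_lt_add fun ε hε => ?_
  have hc : 0 < ‖c‖ + 1 := by positivity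
  obtain ⟨N, a, b, h, hl⟩ := exists_rep_lt X
    (lt_add_of_pos_right (normProj X) (div_pos hε hc))
  have := normProj_le (X := c • X) (fun l => c • a l) b
    (by rw [h, Finset.smul_sum]; simp_rw [Matrix.smul_vecMulVec])
  simp only [norm_smul, mul_assoc, ← Finset.mul_sum] at this
  have h3 : ‖c‖ * (ε / (‖c‖ + 1)) < ε := by
    rw [mul_div_assoc', div_lt_iff₀ hc]; nlinarith
  nlinarith [mul_le_mul_of_nonneg_left hl.le (norm_nonneg c)]

/-- A crude bound, enough to make the projective norm negligible on approximation errors and to show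
that suprema of it are finite. -/
theorem normProj_le_of_entry_le {X : Matrix (Fin m) (Fin n) ℂ} {ε : ℝ}
    (h : ∀ i j, ‖X i j‖ ≤ ε) : normProj X ≤ m * n * ε := by
  have h1 := normProj_le (X := X) (ι := Fin m × Fin n) (fun p => Pi.single p.1 (X p.1 p.2))
    (fun p => Pi.single p.2 1) (by
      ext i j
      rw [Matrix.sum_apply, Fintype.sum_prod_type, Finset.sum_eq_single i
        (fun i' _ h => by simp [Matrix.vecMulVec_apply, h.symm]) (by simp),
        Finset.sum_eq_single j
        (fun i' _ h => by simp [Matrix.vecMulVec_apply, h.symm]) (by simp)]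
      simp [Matrix.vecMulVec_apply])
  refine h1.trans ?_
  calc _ ≤ ∑ p : Fin m × Fin n, ε := Finset.sum_le_sum fun p _ => by
        simpa [Pi.norm_single] using h p.1 p.2
    _ = _ := by simp

theorem convex_normProj_le (r : ℝ) :
    Convex ℝ {X : Matrix (Fin m) (Fin n) ℂ | normProj X ≤ r} := by
  intro X hX Y hY s t hs ht hst
  have h1 := normProj_smul_le (s : ℂ) X
  have h2 := normProj_smul_le (t : ℂ) Y
  rw [Complex.norm_real, Real.norm_of_nonneg hs] at h1
  rw [Complex.norm_real, Real.norm_of_nonneg ht] at h2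
  have h3 := normProj_add_le ((s : ℂ) • X) ((t : ℂ) • Y)
  have hX' : normProj X ≤ r := hX
  have hY' : normProj Y ≤ r := hY
  calc normProj (s • X + t • Y) = normProj ((s : ℂ) • X + (t : ℂ) • Y) := rfl
    _ ≤ s * r + t * r := by nlinarith
    _ = r := by rw [← add_mul, hst, one_mul]

end Projective

/-! ### Gram matrices and the bound `k_G ≤ K_G` -/

/-- The Schur multiplier by the Gram matrix of vectors in the unit ball is a contraction. -/
theorem normS_gram_le_one {n k : ℕ} (u : Fin n → EuclideanSpace ℂ (Fin k)) (hu : ∀ j, ‖u j‖ ≤ 1) :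
    normS (Matrix.of fun i j => ∑ s, star (u i s) * u j s) ≤ 1 := by
  refine ContinuousLinearMap.opNorm_le_bound _ zero_le_one fun A => ?_
  rw [one_mul]
  refine l2_opNorm_le_of_unit _ (norm_nonneg _) fun x hx => ?_
  -- The multiplier factors as `V* (A ⊗ 1) V` with the contraction `V x = (x j • u j)_j`.
  have h0 : ∀ i, ∑ j, (Matrix.hadamard (Matrix.of fun i j => ∑ s, star (u i s) * u j s) A) i j * x j
      = ∑ s, star (u i s) * ∑ j, A i j * (u j s * x j) := by
    intro i
    simp only [Matrix.hadamard_apply, Matrix.of_apply, Finset.sum_mul, Finset.mul_sum]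
    rw [Finset.sum_comm]
    exact Finset.sum_congr rfl fun _ _ => Finset.sum_congr rfl fun _ _ => by ring
  calc _ = ∑ i, ‖∑ s, star (u i s) * ∑ j, A i j * (u j s * x j)‖ ^ 2 :=
        Finset.sum_congr rfl fun i _ => by rw [← h0]; rfl
    _ ≤ ∑ i, ∑ s, ‖∑ j, A i j * (u j s * x j)‖ ^ 2 := by
        refine Finset.sum_le_sum fun i _ => ?_
        set y : EuclideanSpace ℂ (Fin k) := WithLp.toLp 2 fun s => ∑ j, A i j * (u j s * x j)
        have h1 := norm_inner_le_norm (𝕜 := ℂ) (u i) y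
        have h2 : ‖inner ℂ (u i) y‖ ≤ ‖y‖ := h1.trans (mul_le_of_le_one_left (norm_nonneg _) (hu i))
        have h3 := pow_le_pow_left₀ (norm_nonneg _) h2 2
        rw [EuclideanSpace.norm_sq_eq] at h3
        refine le_trans (le_of_eq ?_) h3
        congr 2
        rw [PiLp.inner_apply]
        exact Finset.sum_congr rfl fun s _ => mul_comm _ _
    _ = ∑ s, ∑ i, ‖∑ j, A i j * (u j s * x j)‖ ^ 2 := Finset.sum_comm
    _ ≤ ∑ s, (‖A‖ * ‖(WithLp.toLp 2 fun j => u j s * x j : EuclideanSpace ℂ (Fin n))‖) ^ 2 :=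
        Finset.sum_le_sum fun s _ => sum_norm_sq_le_l2_opNorm A (WithLp.toLp 2 fun j => u j s * x j)
    _ = ‖A‖ ^ 2 * ∑ j, ‖u j‖ ^ 2 * ‖x j‖ ^ 2 := by
        simp only [mul_pow, ← Finset.mul_sum, EuclideanSpace.norm_sq_eq, norm_mul]
        rw [Finset.sum_comm]
        simp only [Finset.sum_mul]
    _ ≤ ‖A‖ ^ 2 * ∑ j, ‖x j‖ ^ 2 := by
        gcongr with j
        exact mul_le_of_le_one_left (sq_nonneg _) (pow_le_one₀ (norm_nonneg _) (hu j))
    _ = ‖A‖ ^ 2 := by rw [← EuclideanSpace.norm_sq_eq, hx]; ring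

/-- A bound on a positive semidefinite form on scalar families bounds the associated
sesquilinear form. -/
theorem norm_sum_vecMulVec_le {m n : ℕ} (X : Matrix (Fin m) (Fin n) ℂ) (a b : Fin n → ℂ) :
    ‖∑ i, star (∑ j, X i j * star (a j)) * ∑ j, X i j * b j‖ ≤ normF X ^ 2 * (‖a‖ * ‖b‖) := by
  have h := norm_inner_le_norm (𝕜 := ℂ) (opF X (star a)) (opF X b)
  refine le_trans (le_of_eq ?_) (h.trans ?_)
  · rw [PiLp.inner_apply]
    congr 1
    exact Finset.sum_congr rfl fun s _ => mul_comm _ _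
  · calc _ ≤ (normF X * ‖star a‖) * (normF X * ‖b‖) := by
          exact mul_le_mul ((opF X).le_opNorm _) ((opF X).le_opNorm _) (norm_nonneg _)
            (mul_nonneg (normF_nonneg X) (norm_nonneg _))
      _ = _ := by rw [norm_star]; ring

theorem le_of_forall_pos_le_add_mul {a b C : ℝ} (h : ∀ ε > 0, a ≤ b + ε * C) : a ≤ b := by
  by_contra! hab
  have hC : 0 < |C| + 1 := by positivity
  have h1 := h ((a - b) / (2 * (|C| + 1))) (div_pos (by linarith) (by linarith))
  have h2 : (a - b) / (2 * (|C| + 1)) * C ≤ (a - b) / 2 := by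
    rw [div_mul_eq_mul_div, div_le_div_iff₀ (by linarith) two_pos]
    nlinarith [le_abs_self C]
  linarith

theorem littleConstants_of_bigConstants {c : ℝ} (hc : c ∈ bigConstants) : c ∈ littleConstants := by
  refine ⟨hc.1, fun m n X => normcbF_le_of_vector_bound hc.1.le X fun k u hu => ?_⟩
  set W : Matrix (Fin n) (Fin n) ℂ := Matrix.of fun i j => ∑ s, star (u i s) * u j s with hW
  have hWc : normProj W ≤ c :=
    (hc.2 n n W).trans (mul_le_of_le_one_right hc.1.le (normS_gram_le_one u hu))
  refine le_of_forall_pos_le_add_mul (C := normF X ^ 2) fun ε hε => ?_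
  obtain ⟨N, a, b, hab, hl⟩ := exists_rep_lt W (r := c + ε) (by linarith)
  -- The vector form is the matrix `X* X` paired with `W`; inserting a rank one decomposition of `W`
  -- leaves only scalar forms.
  have h1 : ((∑ i, ‖∑ j, X i j • u j‖ ^ 2 : ℝ) : ℂ) =
      ∑ i, ∑ j, ∑ j', star (X i j) * X i j' * W j j' := by
    push_cast
    refine Finset.sum_congr rfl fun i _ => ?_
    rw [← Complex.ofReal_pow, EuclideanSpace.norm_sq_eq]
    push_cast
    have : ∀ s, (‖(∑ j, X i j • u j) s‖ : ℂ) ^ 2 =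
        ∑ j, ∑ j', star (X i j) * X i j' * (star (u j s) * u j' s) := by
      intro s
      rw [← Complex.conj_mul', ← Complex.star_def]
      simp only [WithLp.ofLp_sum, WithLp.ofLp_smul, Finset.sum_apply, Pi.smul_apply, smul_eq_mul,
        star_sum, star_mul', Finset.sum_mul_sum]
      exact Finset.sum_congr rfl fun _ _ => Finset.sum_congr rfl fun _ _ => by ring
    simp_rw [this, hW, Matrix.of_apply, Finset.mul_sum]
    rw [Finset.sum_comm]
    exact Finset.sum_congr rfl fun _ _ => by rw [Finset.sum_comm]
  have h2 : ∑ i, ∑ j, ∑ j', star (X i j) * X i j' * W j j' =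
      ∑ l, ∑ i, star (∑ j, X i j * star (a l j)) * ∑ j, X i j * b l j := by
    rw [Finset.sum_comm (s := (Finset.univ : Finset (Fin N)))]
    refine Finset.sum_congr rfl fun i _ => ?_
    simp only [star_sum, star_mul', star_star, Finset.sum_mul_sum]
    rw [Finset.sum_comm (s := (Finset.univ : Finset (Fin N)))]
    refine Finset.sum_congr rfl fun j _ => ?_
    rw [Finset.sum_comm (s := (Finset.univ : Finset (Fin N)))]
    refine Finset.sum_congr rfl fun j' _ => ?_
    rw [hab, Matrix.sum_apply, Finset.mul_sum]
    exact Finset.sum_congr rfl fun l _ => by rw [Matrix.vecMulVec_apply]; ring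
  have h3 := congrArg norm (h1.trans h2)
  rw [Complex.norm_real, Real.norm_of_nonneg (by positivity)] at h3
  rw [h3, ← add_mul]
  calc _ ≤ ∑ l, normF X ^ 2 * (‖a l‖ * ‖b l‖) :=
        (norm_sum_le _ _).trans (Finset.sum_le_sum fun l _ => norm_sum_vecMulVec_le X (a l) (b l))
    _ = (∑ l, ‖a l‖ * ‖b l‖) * normF X ^ 2 := by rw [← Finset.mul_sum, mul_comm]
    _ ≤ _ := mul_le_mul_of_nonneg_right hl.le (sq_nonneg _)

end GrothendieckConstants

/-! ### Separation: what `LittleIneq` says about unit-diagonal matrices -/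

namespace GrothendieckConstants
open scoped Matrix ComplexOrder Matrix.Norms.Elementwise Pointwise

instance locallyConvexSpace_matrix {ι : Type*} : LocallyConvexSpace ℝ (Matrix ι ι ℂ) :=
  inferInstanceAs (LocallyConvexSpace ℝ (ι → ι → ℂ))

/-- After division by `d` the diagonal is at most one, and adding the missing nonnegative diagonal
leaves all other entries alone. -/
theorem exists_posSemidef_unit_diag {ι : Type*} [DecidableEq ι] {M : Matrix ι ι ℂ}
    (hM : M.PosSemidef) {d : ℝ} (hd : 0 < d)
    (h : ∀ i, (M i i).re ≤ d) :
    ∃ M' : Matrix ι ι ℂ, M'.PosSemidef ∧ (∀ i, M' i i = 1) ∧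
      ∀ i j, i ≠ j → M i j = (d : ℂ) * M' i j := by
  have hdc : (d : ℂ) ≠ 0 := by exact_mod_cast hd.ne'
  refine ⟨d⁻¹ • M + Matrix.diagonal fun i => 1 - (d : ℂ)⁻¹ * M i i, ?_, fun i => ?_,
    fun i j hij => ?_⟩
  · refine (hM.smul (inv_nonneg.2 hd.le)).add (Matrix.PosSemidef.diagonal fun i => ?_)
    have h0 := hM.diag_nonneg (i := i)
    rw [Complex.nonneg_iff] at h0
    have h1 : M i i = ((M i i).re : ℂ) := Complex.ext rfl h0.2.symm
    have h2 : (0 : ℝ) ≤ 1 - d⁻¹ * (M i i).re := by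
      have : d⁻¹ * (M i i).re ≤ d⁻¹ * d := mul_le_mul_of_nonneg_left (h i) (inv_nonneg.2 hd.le)
      rw [inv_mul_cancel₀ hd.ne'] at this
      linarith
    rw [h1]
    change (0 : ℂ) ≤ _
    exact_mod_cast h2
  · simp [Complex.real_smul]
  · simp [Matrix.diagonal_apply_ne _ hij, Complex.real_smul, hdc]

section PosSemidef

theorem convex_posSemidef {ι : Type*} : Convex ℝ {R : Matrix ι ι ℂ | R.PosSemidef} := by
  intro A hA B hB s t hs ht _
  exact (Matrix.PosSemidef.smul hA hs).add (Matrix.PosSemidef.smul hB ht)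


variable {ι : Type*} [Fintype ι]

theorem map_eq_sum_single [DecidableEq ι] (f : Matrix ι ι ℂ →ₗ[ℂ] ℂ) (A : Matrix ι ι ℂ) :
    f A = ∑ i, ∑ j, A i j * f (Matrix.single i j 1) := by
  conv_lhs => rw [Matrix.matrix_eq_sum_single A]
  simp only [map_sum]
  refine Finset.sum_congr rfl fun i _ => Finset.sum_congr rfl fun j _ => ?_
  rw [← smul_eq_mul, ← map_smul, Matrix.smul_single, smul_eq_mul, mul_one]

/-- A functional which is nonnegative on positive semidefinite matrices of rank one is a sum of
squares there. -/
theorem exists_sum_sq_of_nonneg (f : Matrix ι ι ℂ →ₗ[ℂ] ℂ)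
    (hf : ∀ x : ι → ℂ, 0 ≤ (f (Matrix.vecMulVec x (star x))).re) :
    ∃ (d : ℕ) (Y : Matrix (Fin d) ι ℂ), ∀ x : ι → ℂ,
      (f (Matrix.vecMulVec x (star x))).re = ∑ l, ‖∑ j, Y l j * x j‖ ^ 2 := by
  classical
  set Q : Matrix ι ι ℂ := Matrix.of fun i j => f (Matrix.single j i 1) with hQ
  have hfQ : ∀ x : ι → ℂ, f (Matrix.vecMulVec x (star x)) = star x ⬝ᵥ (Q *ᵥ x) := by
    intro x
    rw [map_eq_sum_single]
    simp only [dotProduct, Matrix.mulVec, Finset.mul_sum, Matrix.vecMulVec_apply, hQ,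
      Matrix.of_apply]
    rw [Finset.sum_comm]
    exact Finset.sum_congr rfl fun _ _ => Finset.sum_congr rfl fun _ _ => by ring
  -- The real part of the form belongs to the Hermitian part of `Q`.
  set H : Matrix ι ι ℂ := (1 / 2 : ℂ) • (Q + Qᴴ) with hH
  have hHx : ∀ x : ι → ℂ, star x ⬝ᵥ (H *ᵥ x) = ((f (Matrix.vecMulVec x (star x))).re : ℂ) := by
    intro x
    have h1 : star x ⬝ᵥ (Qᴴ *ᵥ x) = star (star x ⬝ᵥ (Q *ᵥ x)) := by
      rw [Matrix.star_dotProduct, Matrix.star_mulVec, Matrix.dotProduct_mulVec,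
        Matrix.conjTranspose_conjTranspose, ← Matrix.dotProduct_mulVec]
    rw [hH, Matrix.smul_mulVec, Matrix.add_mulVec, dotProduct_smul, dotProduct_add, h1, ← hfQ,
      Complex.re_eq_add_conj, Complex.star_def, smul_eq_mul]
    ring
  have hpsd : H.PosSemidef := by
    refine Matrix.PosSemidef.of_dotProduct_mulVec_nonneg ?_ fun x => ?_
    · rw [Matrix.IsHermitian, hH, Matrix.conjTranspose_smul, Matrix.conjTranspose_add,
        Matrix.conjTranspose_conjTranspose, add_comm]
      simp
    · rw [hHx]; exact_mod_cast hf x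
  obtain ⟨d, v, hv⟩ := Matrix.posSemidef_iff_eq_sum_vecMulVec.1 hpsd
  refine ⟨d, Matrix.of fun l j => star (v l j), fun x => ?_⟩
  have h1 : ((f (Matrix.vecMulVec x (star x))).re : ℂ) =
      ((∑ l, ‖∑ j, star (v l j) * x j‖ ^ 2 : ℝ) : ℂ) := by
    rw [← hHx, hv, Matrix.sum_mulVec, dotProduct_sum]
    push_cast
    refine Finset.sum_congr rfl fun l _ => ?_
    rw [← Complex.conj_mul', ← Complex.star_def, star_sum, Matrix.vecMulVec_mulVec,
      op_smul_eq_smul, dotProduct_smul, smul_eq_mul, mul_comm]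
    simp only [dotProduct, star_mul', star_star, Pi.star_apply]
    congr 1
    exact Finset.sum_congr rfl fun _ _ => mul_comm _ _
  exact_mod_cast h1

theorem norm_apply_le_one_of_posSemidef {M : Matrix ι ι ℂ} (hM : M.PosSemidef)
    (h : ∀ i, M i i = 1)
    (i j : ι) : ‖M i j‖ ≤ 1 := by
  obtain ⟨d, v, hv⟩ := Matrix.posSemidef_iff_eq_sum_vecMulVec.1 hM
  let w : ι → EuclideanSpace ℂ (Fin d) := fun i => WithLp.toLp 2 fun l => v l i
  have hw : ∀ i j, M i j = inner ℂ (w j) (w i) := by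
    intro i j
    rw [hv, Matrix.sum_apply, PiLp.inner_apply]
    rfl
  have hw1 : ∀ i, ‖w i‖ = 1 := by
    intro i
    have h1 := inner_self_eq_norm_sq_to_K (𝕜 := ℂ) (w i)
    rw [← hw, h] at h1
    have h2 : ‖w i‖ ^ 2 = 1 := Complex.ofReal_injective (by simpa using h1.symm)
    exact (pow_eq_one_iff_of_nonneg (norm_nonneg _) two_ne_zero).1 h2
  rw [hw]
  refine (norm_inner_le_norm _ _).trans ?_
  rw [hw1, hw1, one_mul]

/-- This is the dual of `LittleIneq`. Subtracting the positive semidefinite cone forces a separating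
functional to be a sum of squares on rank one matrices; the inequality for that form bounds its
value at `W` by the separating constant. -/
theorem LittleIneq.mem_closure {ι : Type} [Fintype ι] {c : ℝ} (hc0 : 0 < c) (hc : LittleIneq c)
    {W : Matrix ι ι ℂ} (hW : W.PosSemidef) (hd : ∀ i, W i i = 1) :
    W ∈ closure (c • convexHull ℝ {Z : Matrix ι ι ℂ | ∃ z : ι → ℂ, (∀ j, ‖z j‖ ≤ 1) ∧
      Z = Matrix.vecMulVec z (star z)} - {R : Matrix ι ι ℂ | R.PosSemidef}) := by
  by_contra hcl
  obtain ⟨f, s, hf, hs⟩ := RCLike.geometric_hahn_banach_closed_point (𝕜 := ℂ)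
    (((convex_convexHull ℝ _).smul c).sub convex_posSemidef).closure isClosed_closure hcl
  have hmem : ∀ (z : ι → ℂ) (R : Matrix ι ι ℂ), (∀ j, ‖z j‖ ≤ 1) → R.PosSemidef →
      c * (f (Matrix.vecMulVec z (star z))).re - (f R).re < s := by
    intro z R hz hR
    have := hf _ (subset_closure (Set.sub_mem_sub
      (Set.smul_mem_smul_set (a := c) (subset_convexHull ℝ _ ⟨z, hz, rfl⟩)) hR))
    rw [map_sub, ← Complex.coe_smul, map_smul] at this
    simpa using this
  have hpos : ∀ x : ι → ℂ, 0 ≤ (f (Matrix.vecMulVec x (star x))).re := by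
    intro x
    by_contra! hneg
    have hs0 : 0 < s := by simpa using hmem 0 0 (by simp) .zero
    -- This multiple of `x x*` makes the functional equal to `s`, contradicting the strict bound.
    have ht : 0 ≤ s / -(f (Matrix.vecMulVec x (star x))).re := (div_pos hs0 (by linarith)).le
    have := hmem 0 ((s / -(f (Matrix.vecMulVec x (star x))).re) • Matrix.vecMulVec x (star x))
      (by simp) ((Matrix.posSemidef_vecMulVec_self_star x).smul ht)
    rw [← Complex.coe_smul, map_smul, smul_eq_mul, Complex.re_ofReal_mul] at this
    rw [div_mul_eq_mul_div, div_neg, mul_div_assoc, div_self hneg.ne] at this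
    simp at this
  obtain ⟨d, Y, hY⟩ := exists_sum_sq_of_nonneg (f : Matrix ι ι ℂ →ₗ[ℂ] ℂ) hpos
  obtain ⟨k, v, hv⟩ := Matrix.posSemidef_iff_eq_sum_vecMulVec.1 hW
  have h1 := hc _ _ Y (s / c) (fun z hz => ?_) k (fun j => WithLp.toLp 2 fun l => v l j) fun j => ?_
  · rw [mul_div_cancel₀ _ hc0.ne'] at h1
    refine absurd hs (not_lt.2 (le_trans (le_of_eq ?_) h1))
    rw [hv, map_sum]
    simp only [map_sum, EuclideanSpace.norm_sq_eq]
    rw [Finset.sum_comm]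
    refine Finset.sum_congr rfl fun l _ => (hY (v l)).trans (Finset.sum_congr rfl fun i _ => ?_)
    simp
  · rw [← hY, le_div_iff₀ hc0]
    have := hmem z 0 hz .zero
    simp only [map_zero, Complex.zero_re, sub_zero] at this
    exact (mul_comm _ _).trans_le this.le
  · have h2 : (((∑ l, ‖v l j‖ ^ 2 : ℝ)) : ℂ) = 1 := by
      rw [← hd j, hv, Matrix.sum_apply]
      push_cast
      refine Finset.sum_congr rfl fun l _ => ?_
      rw [← Complex.mul_conj']; rfl
    have h3 : ∑ l, ‖v l j‖ ^ 2 = 1 := by exact_mod_cast h2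
    rw [← sq_le_one_iff₀ (norm_nonneg _), EuclideanSpace.norm_sq_eq]
    exact h3.le

end PosSemidef

end GrothendieckConstants

/-! ### Separation: Schur multipliers as blocks of positive semidefinite matrices -/

namespace GrothendieckConstants

section SchurPairing

open scoped Matrix Matrix.Norms.L2Operator

/-- At unit vectors the right side is `1 + 1`, whence the 2. -/
theorem l2_opNorm_le_of_bilinear {m n : ℕ} (A : Matrix (Fin m) (Fin n) ℂ)
    (h : ∀ (x : Fin m → ℂ) (y : Fin n → ℂ),
      ‖∑ i, ∑ j, x i * y j * A i j‖ ≤ ∑ i, ‖x i‖ ^ 2 + ∑ j, ‖y j‖ ^ 2) : ‖A‖ ≤ 2 := by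
  refine l2_opNorm_le_of_unit A two_pos.le fun x hx => ?_
  set v : Fin m → ℂ := fun i => ∑ j, A i j * x j with hv
  set N : ℝ := ∑ i, ‖v i‖ ^ 2 with hN
  have hN0 : 0 ≤ N := by positivity
  rcases hN0.eq_or_lt with h0 | h0
  · change N ≤ _
    rw [← h0]; norm_num
  have h1 := h (fun i => (√N : ℂ)⁻¹ * star (v i)) x
  have hs : √N ^ 2 = N := Real.sq_sqrt hN0
  have hs0 : 0 < √N := Real.sqrt_pos.2 h0
  have h2 : ∑ i, ∑ j, (√N : ℂ)⁻¹ * star (v i) * x j * A i j = ((√N : ℝ) : ℂ) := by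
    have : ∀ i, ∑ j, (√N : ℂ)⁻¹ * star (v i) * x j * A i j
        = (√N : ℂ)⁻¹ * ((‖v i‖ ^ 2 : ℝ) : ℂ) := by
      intro i
      push_cast
      rw [← Complex.conj_mul', ← Complex.star_def]
      nth_rw 3 [hv]
      simp only [Finset.mul_sum]
      exact Finset.sum_congr rfl fun j _ => by ring
    simp_rw [this, ← Finset.mul_sum, ← Complex.ofReal_sum, ← hN]
    rw [← Complex.ofReal_inv, ← Complex.ofReal_mul]
    congr 1
    rw [inv_mul_eq_div, Real.div_sqrt]
  rw [h2, Complex.norm_real, Real.norm_of_nonneg hs0.le, ← EuclideanSpace.norm_sq_eq, hx] at h1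
  have h3 : ∑ i, ‖(√N : ℂ)⁻¹ * star (v i)‖ ^ 2 = 1 := by
    simp only [norm_mul, norm_inv, Complex.norm_real, Real.norm_of_nonneg hs0.le, norm_star,
      mul_pow, ← Finset.mul_sum, ← hN, inv_pow, hs]
    exact inv_mul_cancel₀ h0.ne'
  rw [h3] at h1
  have h4 : √N ≤ 2 := by linarith
  calc N = √N ^ 2 := hs.symm
    _ ≤ 2 ^ 2 := pow_le_pow_left₀ hs0.le h4 2

theorem norm_sum_mul_le_l2_opNorm {m n : ℕ} (A : Matrix (Fin m) (Fin n) ℂ)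
    (x : EuclideanSpace ℂ (Fin m)) (y : EuclideanSpace ℂ (Fin n)) :
    ‖∑ i, star (x i) * ∑ j, A i j * y j‖ ≤ ‖x‖ * (‖A‖ * ‖y‖) := by
  have h := norm_inner_le_norm (𝕜 := ℂ) x (WithLp.toLp 2 (A *ᵥ y))
  refine le_trans (le_of_eq ?_)
    (h.trans (mul_le_mul_of_nonneg_left (Matrix.l2_opNorm_mulVec A y) (norm_nonneg x)))
  rw [PiLp.inner_apply]
  congr 1
  exact Finset.sum_congr rfl fun s _ => mul_comm _ _

theorem normS_nonneg {m n : ℕ} (X : Matrix (Fin m) (Fin n) ℂ) : 0 ≤ normS X :=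
  ContinuousLinearMap.opNorm_nonneg _

/-- The Schur multiplier norm is dominated through its pairing with a matrix `r` that is bounded as
a bilinear form by a sum of two weighted Hilbert norms. -/
theorem norm_sum_mul_le_normS {m n : ℕ} (X r : Matrix (Fin m) (Fin n) ℂ) (l : Fin m → ℝ)
    (μ : Fin n → ℝ) (hl : ∀ i, 0 < l i) (hμ : ∀ j, 0 < μ j)
    (h : ∀ (x : Fin m → ℂ) (y : Fin n → ℂ),
      ‖∑ i, ∑ j, x i * y j * r i j‖ ≤ ∑ i, l i * ‖x i‖ ^ 2 + ∑ j, μ j * ‖y j‖ ^ 2) :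
    ‖∑ i, ∑ j, X i j * r i j‖ ≤ normS X * (∑ i, l i + ∑ j, μ j) := by
  have hls : ∀ i, (√(l i) : ℂ) ≠ 0 := fun i => by
    exact_mod_cast (Real.sqrt_pos.2 (hl i)).ne'
  have hμs : ∀ i, (√(μ i) : ℂ) ≠ 0 := fun i => by
    exact_mod_cast (Real.sqrt_pos.2 (hμ i)).ne'
  -- Rescaling by the weights turns the hypothesis on `r` into `‖A‖ ≤ 2`; the pairing then becomes
  -- the form of `X ⊙ A` at the vectors `√l`, `√μ`, and AM–GM absorbs the 2.
  set A : Matrix (Fin m) (Fin n) ℂ :=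
    Matrix.of fun i j => (√(l i) : ℂ)⁻¹ * (√(μ j) : ℂ)⁻¹ * r i j with hA
  have hA2 : ‖A‖ ≤ 2 := by
    refine l2_opNorm_le_of_bilinear A fun x y => ?_
    have h1 := h (fun i => (√(l i) : ℂ)⁻¹ * x i) (fun j => (√(μ j) : ℂ)⁻¹ * y j)
    refine le_trans (le_of_eq ?_) (h1.trans (le_of_eq ?_))
    · congr 1
      refine Finset.sum_congr rfl fun i _ => Finset.sum_congr rfl fun j _ => ?_
      simp only [hA, Matrix.of_apply]
      ring
    · congr 1 <;> refine Finset.sum_congr rfl fun i _ => ?_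
      · rw [norm_mul, norm_inv, Complex.norm_real, Real.norm_of_nonneg (Real.sqrt_nonneg _),
          mul_pow, inv_pow, Real.sq_sqrt (hl i).le, ← mul_assoc, mul_inv_cancel₀ (hl i).ne',
          one_mul]
      · rw [norm_mul, norm_inv, Complex.norm_real, Real.norm_of_nonneg (Real.sqrt_nonneg _),
          mul_pow, inv_pow, Real.sq_sqrt (hμ i).le, ← mul_assoc, mul_inv_cancel₀ (hμ i).ne',
          one_mul]
  have hXA : ‖Matrix.hadamard X A‖ ≤ normS X * 2 := by
    refine (ContinuousLinearMap.le_opNorm (LinearMap.toContinuousLinearMap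
      { toFun := fun A => Matrix.hadamard X A
        map_add' := fun A B => Matrix.hadamard_add X A B
        map_smul' := fun c A => Matrix.hadamard_smul X A c } :
    Matrix (Fin m) (Fin n) ℂ →L[ℂ] Matrix (Fin m) (Fin n) ℂ) A).trans ?_
    exact mul_le_mul_of_nonneg_left hA2 (normS_nonneg X)
  set x : EuclideanSpace ℂ (Fin m) := WithLp.toLp 2 fun i => (√(l i) : ℂ)
  set y : EuclideanSpace ℂ (Fin n) := WithLp.toLp 2 fun i => (√(μ i) : ℂ)
  have hx : ‖x‖ ^ 2 = ∑ i, l i := by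
    rw [EuclideanSpace.norm_sq_eq]
    exact Finset.sum_congr rfl fun i _ => by
      rw [Complex.norm_real, Real.norm_of_nonneg (Real.sqrt_nonneg _), Real.sq_sqrt (hl i).le]
  have hy : ‖y‖ ^ 2 = ∑ j, μ j := by
    rw [EuclideanSpace.norm_sq_eq]
    exact Finset.sum_congr rfl fun i _ => by
      rw [Complex.norm_real, Real.norm_of_nonneg (Real.sqrt_nonneg _), Real.sq_sqrt (hμ i).le]
  have h1 : ∑ i, ∑ j, X i j * r i j
      = ∑ i, star (x i) * ∑ j, Matrix.hadamard X A i j * y j := by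
    refine Finset.sum_congr rfl fun i _ => ?_
    rw [Finset.mul_sum]
    refine Finset.sum_congr rfl fun j _ => ?_
    simp only [x, y, Matrix.hadamard_apply, hA, Matrix.of_apply, Complex.star_def,
      Complex.conj_ofReal]
    field_simp [hls i, hμs j]
  have hS := normS_nonneg X
  calc _ ≤ ‖x‖ * (‖Matrix.hadamard X A‖ * ‖y‖) := by
        rw [h1]; exact norm_sum_mul_le_l2_opNorm _ x y
    _ ≤ ‖x‖ * (normS X * 2 * ‖y‖) := by gcongr
    _ = normS X * (2 * ‖x‖ * ‖y‖) := by ring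
    _ ≤ normS X * (‖x‖ ^ 2 + ‖y‖ ^ 2) := by gcongr; exact two_mul_le_add_sq _ _
    _ = _ := by rw [hx, hy]

end SchurPairing

open scoped Matrix ComplexOrder Matrix.Norms.Elementwise Pointwise

theorem map_fromBlocks_diagonal {m n : ℕ}
    (f : Matrix (Fin m ⊕ Fin n) (Fin m ⊕ Fin n) ℂ →ₗ[ℂ] ℂ) (d : Fin m → ℝ) (e : Fin n → ℝ)
    (Z : Matrix (Fin m) (Fin n) ℂ) :
    (f (Matrix.fromBlocks (Matrix.diagonal fun i => (d i : ℂ)) Z Zᴴ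
      (Matrix.diagonal fun j => (e j : ℂ)))).re =
    ∑ i, (f (Matrix.single (Sum.inl i) (Sum.inl i) 1)).re * d i +
      ∑ j, (f (Matrix.single (Sum.inr j) (Sum.inr j) 1)).re * e j +
      (∑ i, ∑ j, Z i j * (f (Matrix.single (Sum.inl i) (Sum.inr j) 1) +
        star (f (Matrix.single (Sum.inr j) (Sum.inl i) 1)))).re := by
  rw [map_eq_sum_single]
  simp only [Fintype.sum_sum_type, Matrix.fromBlocks_apply₁₁, Matrix.fromBlocks_apply₁₂,
    Matrix.fromBlocks_apply₂₁, Matrix.fromBlocks_apply₂₂, Matrix.diagonal_apply, ite_mul, zero_mul,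
    Finset.sum_ite_eq, Finset.mem_univ, if_true, Finset.sum_add_distrib, mul_add, Complex.add_re,
    Matrix.conjTranspose_apply]
  have h1 : (∑ j, ∑ i, star (Z i j) * f (Matrix.single (Sum.inr j) (Sum.inl i) 1)).re =
      (∑ i, ∑ j, Z i j * star (f (Matrix.single (Sum.inr j) (Sum.inl i) 1))).re := by
    rw [Finset.sum_comm]
    simp only [Complex.re_sum]
    refine Finset.sum_congr rfl fun i _ => Finset.sum_congr rfl fun j _ => ?_
    simp
  rw [h1]
  simp only [Complex.re_sum, Complex.re_ofReal_mul]
  simp only [mul_comm (d _), mul_comm (e _)]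
  ring

/-- The matrices with vanishing off-diagonal blocks and with diagonal entries of nonnegative real
part. -/
def blockDiagonalCone (m n : ℕ) : Set (Matrix (Fin m ⊕ Fin n) (Fin m ⊕ Fin n) ℂ) :=
  {H | (∀ i j, H (Sum.inl i) (Sum.inr j) = 0) ∧ (∀ i j, H (Sum.inr j) (Sum.inl i) = 0) ∧
    ∀ p, 0 ≤ (H p p).re}

theorem blockDiagonalCone_smul {m n : ℕ} {H} (hH : H ∈ blockDiagonalCone m n) {t : ℝ}
    (ht : 0 ≤ t) : t • H ∈ blockDiagonalCone m n := by
  refine ⟨fun i j => by simp [hH.1], fun i j => by simp [hH.2.1], fun p => ?_⟩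
  simpa using mul_nonneg ht (hH.2.2 p)

theorem convex_blockDiagonalCone (m n : ℕ) : Convex ℝ (blockDiagonalCone m n) := by
  intro A hA B hB s t hs ht _
  refine ⟨fun i j => by simp [hA.1, hB.1], fun i j => by simp [hA.2.1, hB.2.1], fun p => ?_⟩
  simpa using add_nonneg (mul_nonneg hs (hA.2.2 p)) (mul_nonneg ht (hB.2.2 p))

theorem zero_mem_blockDiagonalCone (m n : ℕ) : 0 ∈ blockDiagonalCone m n :=
  ⟨fun _ _ => rfl, fun _ _ => rfl, fun _ => le_rfl⟩

/-- A functional separating this matrix from the cone is nonnegative on the cone. Rank one positive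
semidefinite matrices then show that its off-diagonal part `r` is dominated by its diagonal weights,
so `norm_sum_mul_le_normS` makes its value here nonnegative as well, a contradiction. -/
theorem fromBlocks_mem_closure {m n : ℕ} (X : Matrix (Fin m) (Fin n) ℂ) :
    Matrix.fromBlocks (Matrix.diagonal fun _ => (normS X : ℂ)) X Xᴴ
      (Matrix.diagonal fun _ => (normS X : ℂ)) ∈
    closure ({M : Matrix (Fin m ⊕ Fin n) (Fin m ⊕ Fin n) ℂ | M.PosSemidef} +
      blockDiagonalCone m n) := by
  by_contra hcl
  obtain ⟨f, u, hu, hf⟩ := RCLike.geometric_hahn_banach_point_closed (𝕜 := ℂ)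
    (convex_posSemidef.add (convex_blockDiagonalCone m n)).closure isClosed_closure hcl
  have hu0 : u < 0 := by
    simpa using hf 0 (subset_closure ⟨0, .zero, 0, zero_mem_blockDiagonalCone m n, add_zero 0⟩)
  have hcone : ∀ K : Matrix (Fin m ⊕ Fin n) (Fin m ⊕ Fin n) ℂ,
      (∀ t : ℝ, 0 ≤ t → u < (f (t • K)).re) → 0 ≤ (f K).re := by
    intro K hK
    by_contra! hneg
    have := hK (u / (f K).re) (div_nonneg_of_nonpos hu0.le hneg.le)
    rw [← Complex.coe_smul, map_smul, smul_eq_mul, Complex.re_ofReal_mul,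
      div_mul_cancel₀ _ hneg.ne] at this
    exact lt_irrefl _ this
  have hM : ∀ M : Matrix (Fin m ⊕ Fin n) (Fin m ⊕ Fin n) ℂ, M.PosSemidef → 0 ≤ (f M).re :=
    fun M hM => hcone M fun t ht => hf _ (subset_closure
      ⟨t • M, hM.smul ht, 0, zero_mem_blockDiagonalCone m n, add_zero _⟩)
  have hH : ∀ H ∈ blockDiagonalCone m n, 0 ≤ (f H).re :=
    fun H hH => hcone H fun t ht => hf _ (subset_closure
      ⟨0, .zero, t • H, blockDiagonalCone_smul hH ht, zero_add _⟩)
  set l : Fin m → ℝ := fun i => (f (Matrix.single (Sum.inl i) (Sum.inl i) 1)).re with hl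
  set μ : Fin n → ℝ := fun j => (f (Matrix.single (Sum.inr j) (Sum.inr j) 1)).re with hμ
  set r : Matrix (Fin m) (Fin n) ℂ := Matrix.of fun i j =>
    f (Matrix.single (Sum.inl i) (Sum.inr j) 1) +
        star (f (Matrix.single (Sum.inr j) (Sum.inl i) 1)) with hr
  have hfb : ∀ (d : Fin m → ℝ) (e : Fin n → ℝ) (Z : Matrix (Fin m) (Fin n) ℂ),
      (f (Matrix.fromBlocks (Matrix.diagonal fun i => (d i : ℂ)) Z Zᴴ
        (Matrix.diagonal fun j => (e j : ℂ)))).re =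
      ∑ i, l i * d i + ∑ j, μ j * e j + (∑ i, ∑ j, Z i j * r i j).re :=
    fun d e Z => map_fromBlocks_diagonal (f : _ →ₗ[ℂ] ℂ) d e Z
  have hl0 : ∀ i, 0 ≤ l i := fun i => hH _ ⟨by simp, by simp, fun p => by
      rw [Matrix.single_apply]; split_ifs <;> simp⟩
  have hμ0 : ∀ i, 0 ≤ μ i := fun i => hH _ ⟨by simp, by simp, fun p => by
      rw [Matrix.single_apply]; split_ifs <;> simp⟩
  have hpos : ∀ (x : Fin m → ℂ) (y : Fin n → ℂ), 0 ≤ ∑ i, l i * ‖x i‖ ^ 2 +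
      ∑ j, μ j * ‖y j‖ ^ 2 + (∑ i, ∑ j, x i * y j * r i j).re := by
    intro x y
    set w : Fin m ⊕ Fin n → ℂ := Sum.elim x (star y) with hw
    set N := Matrix.fromBlocks (Matrix.diagonal fun i => ((‖x i‖ ^ 2 : ℝ) : ℂ))
      (Matrix.vecMulVec x y) (Matrix.vecMulVec x y)ᴴ
      (Matrix.diagonal fun j => ((‖y j‖ ^ 2 : ℝ) : ℂ)) with hN
    have h1 := hM _ (Matrix.posSemidef_vecMulVec_self_star w)
    -- The diagonals agree, and the cone leaves the other entries of the diagonal blocks free, so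
    -- these can be erased.
    have h2 : N - Matrix.vecMulVec w (star w) ∈ blockDiagonalCone m n := by
      refine ⟨fun i j => by simp [hN, hw, Matrix.vecMulVec_apply],
        fun i j => by simp [hN, hw, Matrix.vecMulVec_apply, mul_comm], ?_⟩
      rintro (i | j)
      · simp [hN, hw, Matrix.vecMulVec_apply, Complex.mul_conj, Complex.sq_norm]
      · simp [hN, hw, Matrix.vecMulVec_apply, Complex.sq_norm, Complex.normSq_apply]
    have h3 := hH _ h2
    rw [map_sub, Complex.sub_re] at h3
    have h4 := hfb (fun i => ‖x i‖ ^ 2) (fun j => ‖y j‖ ^ 2) (Matrix.vecMulVec x y)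
    simp only [Matrix.vecMulVec_apply] at h4
    rw [← h4]
    linarith
  have hbd : ∀ (x : Fin m → ℂ) (y : Fin n → ℂ),
      ‖∑ i, ∑ j, x i * y j * r i j‖ ≤ ∑ i, l i * ‖x i‖ ^ 2 + ∑ j, μ j * ‖y j‖ ^ 2 := by
    intro x y
    set v := ∑ i, ∑ j, x i * y j * r i j with hv
    -- Rotating `x` by a phase turns the real part in `hpos` into minus the modulus.
    obtain ⟨θ, hθ, hθv⟩ : ∃ θ : ℂ, ‖θ‖ = 1 ∧ θ * v = -‖v‖ := by
      by_cases h0 : v = 0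
      · exact ⟨1, by simp, by simp [h0]⟩
      · have : (‖v‖ : ℂ) ≠ 0 := by simpa using h0
        refine ⟨-star v / ‖v‖, by simp [h0], ?_⟩
        rw [div_mul_eq_mul_div, neg_mul, Complex.star_def, Complex.conj_mul']
        field_simp
    have h1 := hpos (fun i => θ * x i) y
    have h2 : ∑ i, ∑ j, θ * x i * y j * r i j = -(‖v‖ : ℂ) := by
      rw [← hθv, hv, Finset.mul_sum]
      refine Finset.sum_congr rfl fun i _ => ?_
      rw [Finset.mul_sum]
      exact Finset.sum_congr rfl fun i _ => by ring
    rw [h2] at h1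
    simp only [norm_mul, hθ, one_mul, Complex.neg_re, Complex.ofReal_re] at h1
    linarith
  have hX : ‖∑ i, ∑ j, X i j * r i j‖ ≤ normS X * (∑ i, l i + ∑ j, μ j) := by
    -- The weights may vanish, so each is raised by `ε` to permit the rescaling.
    refine le_of_forall_pos_le_add_mul (C := normS X * (m + n)) fun ε hε => ?_
    have := norm_sum_mul_le_normS X r (fun i => l i + ε) (fun j => μ j + ε)
      (fun i => by linarith [hl0 i]) (fun j => by linarith [hμ0 j]) fun x y => by
        refine (hbd x y).trans ?_
        gcongr <;> linarith
    refine this.trans (le_of_eq ?_)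
    simp only [Finset.sum_add_distrib, Finset.sum_const, Finset.card_univ, Fintype.card_fin,
      nsmul_eq_mul]
    ring
  have h1 := hfb (fun _ => normS X) (fun _ => normS X) X
  have h2 := (Complex.abs_re_le_norm _).trans hX
  have h3 := (abs_le.1 h2).1
  rw [← Finset.sum_mul, ← Finset.sum_mul] at h1
  have h4 : (f (Matrix.fromBlocks (Matrix.diagonal fun _ => (normS X : ℂ)) X Xᴴ
      (Matrix.diagonal fun _ => (normS X : ℂ)))).re < u := hu
  linarith

end GrothendieckConstants

/-! ### The self-improving bound on the projective norm of Gram blocks -/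

namespace GrothendieckConstants

open scoped Matrix ComplexOrder Matrix.Norms.Elementwise Pointwise

theorem exists_entry_close_of_mem_closure {ι : Type*} [Fintype ι] {S : Set (Matrix ι ι ℂ)}
    {W : Matrix ι ι ℂ} (hW : W ∈ closure S) {ε : ℝ} (hε : 0 < ε) :
    ∃ A ∈ S, ∀ i j, ‖W i j - A i j‖ ≤ ε := by
  obtain ⟨A, hA, h⟩ := Metric.mem_closure_iff.1 hW ε hε
  rw [dist_eq_norm] at h
  exact ⟨A, hA, fun i j => (Matrix.norm_entry_le_entrywise_sup_norm (W - A)).trans h.le⟩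

/-- The off-diagonal blocks of positive semidefinite matrices with unit diagonal. -/
def gramBlocks (m n : ℕ) : Set (Matrix (Fin m) (Fin n) ℂ) :=
  {X | ∃ M : Matrix (Fin m ⊕ Fin n) (Fin m ⊕ Fin n) ℂ, M.PosSemidef ∧ (∀ p, M p p = 1) ∧
    X = M.toBlocks₁₂}

variable {m n : ℕ}

/-- Finiteness of the supremum is what allows it to be solved for in `K ≤ c + (c - 1) K`. -/
theorem bddAbove_normProj_gramBlocks : BddAbove (normProj '' gramBlocks m n) := by
  refine ⟨m * n * 1, ?_⟩
  rintro _ ⟨X, ⟨M, hM, hd, rfl⟩, rfl⟩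
  exact normProj_le_of_entry_le fun i j => norm_apply_le_one_of_posSemidef hM hd _ _

theorem normProj_le_sSup {X : Matrix (Fin m) (Fin n) ℂ} (hX : X ∈ gramBlocks m n) :
    normProj X ≤ sSup (normProj '' gramBlocks m n) :=
  le_csSup bddAbove_normProj_gramBlocks ⟨X, hX, rfl⟩

theorem sSup_normProj_gramBlocks_nonneg : 0 ≤ sSup (normProj '' gramBlocks m n) := by
  refine Real.sSup_nonneg ?_
  rintro _ ⟨X, -, rfl⟩
  exact normProj_nonneg X

theorem normProj_toBlocks_le {M : Matrix (Fin m ⊕ Fin n) (Fin m ⊕ Fin n) ℂ} (hM : M.PosSemidef)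
    {d : ℝ} (hd : 0 < d) (h : ∀ p, (M p p).re ≤ d) :
    normProj M.toBlocks₁₂ ≤ d * sSup (normProj '' gramBlocks m n) := by
  obtain ⟨M', hM', hd', h'⟩ := exists_posSemidef_unit_diag hM hd h
  have : M.toBlocks₁₂ = (d : ℂ) • M'.toBlocks₁₂ := by
    ext i j
    exact h' _ _ (by simp)
  rw [this]
  refine (normProj_smul_le _ _).trans ?_
  rw [Complex.norm_real, Real.norm_of_nonneg hd.le]
  exact mul_le_mul_of_nonneg_left (normProj_le_sSup ⟨M', hM', hd', rfl⟩) hd.le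

theorem normProj_toBlocks_le_one {Z : Matrix (Fin m ⊕ Fin n) (Fin m ⊕ Fin n) ℂ}
    (hZ : Z ∈ convexHull ℝ {Z : Matrix (Fin m ⊕ Fin n) (Fin m ⊕ Fin n) ℂ |
      ∃ z : Fin m ⊕ Fin n → ℂ, (∀ j, ‖z j‖ ≤ 1) ∧ Z = Matrix.vecMulVec z (star z)}) :
    normProj Z.toBlocks₁₂ ≤ 1 ∧ ∀ p, (Z p p).re ≤ 1 := by
  have hconv : Convex ℝ {Z : Matrix (Fin m ⊕ Fin n) (Fin m ⊕ Fin n) ℂ |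
      normProj Z.toBlocks₁₂ ≤ 1 ∧ ∀ p, (Z p p).re ≤ 1} := by
    intro A hA B hB s t hs ht hst
    refine ⟨convex_normProj_le 1 hA.1 hB.1 hs ht hst, fun p => ?_⟩
    have h1 := mul_le_mul_of_nonneg_left (hA.2 p) hs
    have h2 := mul_le_mul_of_nonneg_left (hB.2 p) ht
    simp only [Matrix.add_apply, Matrix.smul_apply, Complex.add_re, Complex.smul_re, smul_eq_mul]
    linarith
  refine convexHull_min ?_ hconv hZ
  rintro _ ⟨z, hz, rfl⟩
  refine ⟨?_, fun p => ?_⟩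
  -- The off-diagonal block of `z z*` is itself rank one.
  · refine (normProj_vecMulVec_le (z ∘ Sum.inl) (star z ∘ Sum.inr)).trans ?_
    refine mul_le_one₀ ((pi_norm_le_iff_of_nonneg zero_le_one).2 fun j => hz _) (norm_nonneg _)
      ((pi_norm_le_iff_of_nonneg zero_le_one).2 fun j => ?_)
    simpa using hz (Sum.inr j)
  · rw [Matrix.vecMulVec_apply, Pi.star_apply, Complex.star_def, Complex.mul_conj',
      ← Complex.ofReal_pow, Complex.ofReal_re]
    exact pow_le_one₀ (norm_nonneg _) (hz p)

theorem LittleIneq.sSup_normProj_le {c : ℝ} (hc1 : 1 ≤ c) (hc : LittleIneq c) :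
    sSup (normProj '' gramBlocks m n) ≤ c + (c - 1) * sSup (normProj '' gramBlocks m n) := by
  set K := sSup (normProj '' gramBlocks m n) with hK
  have hc0 : 0 < c := by linarith
  have hK0 : 0 ≤ K := sSup_normProj_gramBlocks_nonneg
  refine Real.sSup_le ?_ (by nlinarith)
  rintro _ ⟨_, ⟨W, hW, hd, rfl⟩, rfl⟩
  refine le_of_forall_pos_le_add_mul (C := K + m * n) fun δ hδ => ?_
  obtain ⟨A, ⟨_, ⟨Z, hZ, rfl⟩, R, hR, rfl⟩, hA⟩ :=
    exists_entry_close_of_mem_closure (hc.mem_closure hc0 hW hd) hδ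
  obtain ⟨hZ1, hZd⟩ := normProj_toBlocks_le_one hZ
  -- On the diagonal `R = c Z - A`, where `Z` is at most 1 and `A` is within `δ` of 1. The `δ` also
  -- keeps `d` positive when `c = 1`.
  have hRK := normProj_toBlocks_le hR (d := c - 1 + δ) (by linarith) fun p => by
    have h1 := (abs_le.1 ((Complex.abs_re_le_norm _).trans (hA p p))).2
    have h2 := mul_le_mul_of_nonneg_left (hZd p) hc0.le
    simp only [hd, Matrix.sub_apply, Matrix.smul_apply, Complex.sub_re, Complex.one_re,
      Complex.smul_re, smul_eq_mul] at h1
    linarith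
  have hE : normProj (W.toBlocks₁₂ - (c • Z - R).toBlocks₁₂) ≤ m * n * δ :=
    normProj_le_of_entry_le fun i j => hA _ _
  have hsplit : W.toBlocks₁₂ = (c : ℂ) • Z.toBlocks₁₂ + (-1 : ℂ) • R.toBlocks₁₂ +
      (W.toBlocks₁₂ - (c • Z - R).toBlocks₁₂) := by
    ext i j
    simp [Matrix.toBlocks₁₂]
    ring
  have h1 := normProj_add_le ((c : ℂ) • Z.toBlocks₁₂ + (-1 : ℂ) • R.toBlocks₁₂)
    (W.toBlocks₁₂ - (c • Z - R).toBlocks₁₂)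
  have h2 := normProj_add_le ((c : ℂ) • Z.toBlocks₁₂) ((-1 : ℂ) • R.toBlocks₁₂)
  have h3 := normProj_smul_le (c : ℂ) Z.toBlocks₁₂
  have h4 := normProj_smul_le (-1 : ℂ) R.toBlocks₁₂
  rw [Complex.norm_real, Real.norm_of_nonneg hc0.le] at h3
  rw [norm_neg, norm_one, one_mul] at h4
  rw [← hsplit] at h1
  have h5 := mul_le_mul_of_nonneg_left hZ1 hc0.le
  rw [← hK] at hRK
  linarith

theorem normProj_le_sSup_mul_normS (X : Matrix (Fin m) (Fin n) ℂ) :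
    normProj X ≤ sSup (normProj '' gramBlocks m n) * normS X := by
  set K := sSup (normProj '' gramBlocks m n) with hK
  have hS := normS_nonneg X
  refine le_of_forall_pos_le_add_mul (C := K + m * n) fun ε hε => ?_
  obtain ⟨A, ⟨M, hM, H, hH, rfl⟩, hA⟩ :=
    exists_entry_close_of_mem_closure (fromBlocks_mem_closure X) hε
  have hMK := normProj_toBlocks_le hM (d := normS X + ε) (by linarith) fun p => by
    have h1 := (abs_le.1 ((Complex.abs_re_le_norm _).trans (hA p p))).1
    have h2 := hH.2.2 p
    rcases p with i | i <;>
    · simp only [Matrix.fromBlocks_apply₁₁, Matrix.fromBlocks_apply₂₂, Matrix.diagonal_apply_eq,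
        Matrix.add_apply, Complex.sub_re, Complex.add_re, Complex.ofReal_re] at h1
      linarith
  -- `H` has no off-diagonal block, so `M` alone approximates `X` there.
  have hE : normProj (X - M.toBlocks₁₂) ≤ m * n * ε := normProj_le_of_entry_le fun i j => by
    have : ‖X i j - (M + H) (Sum.inl i) (Sum.inr j)‖ ≤ ε :=
      hA (Sum.inl i) (Sum.inr j)
    rwa [Matrix.add_apply, hH.1, add_zero] at this
  have h1 := normProj_add_le M.toBlocks₁₂ (X - M.toBlocks₁₂)
  rw [add_sub_cancel] at h1
  rw [← hK] at hMK
  linarith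

theorem LittleIneq.div_mem_bigConstants {c : ℝ} (hc1 : 1 ≤ c) (hc2 : c < 2) (hc : LittleIneq c) :
    c / (2 - c) ∈ bigConstants := by
  refine ⟨div_pos (by linarith) (by linarith), fun m n X => ?_⟩
  have hS := normS_nonneg X
  refine (normProj_le_sSup_mul_normS X).trans (mul_le_mul_of_nonneg_right ?_ hS)
  have h := hc.sSup_normProj_le hc1 (m := m) (n := n)
  rw [le_div_iff₀ (by linarith)]
  linarith

/-! ### Attainment of both constants -/

theorem one_le_of_mem_littleConstants {c : ℝ} (hc : c ∈ littleConstants) : 1 ≤ c := by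
  have h := littleIneq_of_mem hc Unit Unit (fun _ _ => 1) 1 (fun z hz => by
    simpa using hz ()) 1 (fun _ => EuclideanSpace.single 0 1) (by simp)
  simpa using h

theorem csInf_mul_of_forall_le {S : Set ℝ} (hS : S.Nonempty) {a b : ℝ} (hb : 0 ≤ b)
    (h : ∀ c ∈ S, a ≤ c * b) : a ≤ sInf S * b := by
  rcases hb.eq_or_lt with rfl | hb
  · obtain ⟨c, hc⟩ := hS
    simpa using h c hc
  · rw [← div_le_iff₀ hb]
    exact le_csInf hS fun c hc => (div_le_iff₀ hb).2 (h c hc)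

theorem pi_div_two_mem_littleConstants : Real.pi / 2 ∈ littleConstants :=
  mem_littleConstants_iff.2 ⟨by positivity, littleIneq_pi_div_two⟩

theorem bddBelow_littleConstants : BddBelow littleConstants :=
  ⟨1, fun _ hc => one_le_of_mem_littleConstants hc⟩

theorem isLeast_littleConstants : IsLeast littleConstants littleKG := by
  have hne : littleConstants.Nonempty := ⟨_, pi_div_two_mem_littleConstants⟩
  refine ⟨⟨zero_lt_one.trans_le (le_csInf hne fun _ => one_le_of_mem_littleConstants), ?_⟩,
    fun c hc => csInf_le bddBelow_littleConstants hc⟩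
  have h1 : 0 ≤ littleKG := zero_le_one.trans (le_csInf hne fun _ => one_le_of_mem_littleConstants)
  intro m n X
  -- Squaring makes the inequality linear in `c`, so it passes to the infimum.
  refine abs_le_of_sq_le_sq' ?_ (mul_nonneg (Real.sqrt_nonneg _) (normF_nonneg X)) |>.2
  rw [mul_pow, Real.sq_sqrt h1]
  refine csInf_mul_of_forall_le hne (sq_nonneg _) fun c hc => ?_
  have := pow_le_pow_left₀ (normcbF_nonneg X) (hc.2 m n X) 2
  rwa [mul_pow, Real.sq_sqrt hc.1.le] at this

theorem littleKG_lt_two : littleKG < 2 :=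
  (csInf_le bddBelow_littleConstants pi_div_two_mem_littleConstants).trans_lt
    (by linarith [Real.pi_lt_four])

theorem littleKG_div_mem_bigConstants : littleKG / (2 - littleKG) ∈ bigConstants :=
  (littleIneq_of_mem isLeast_littleConstants.1).div_mem_bigConstants
    (one_le_of_mem_littleConstants isLeast_littleConstants.1) littleKG_lt_two

theorem isLeast_bigConstants : IsLeast bigConstants bigKG := by
  have hne : bigConstants.Nonempty := ⟨_, littleKG_div_mem_bigConstants⟩
  have h1 : ∀ c ∈ bigConstants, 1 ≤ c := fun c hc =>
    one_le_of_mem_littleConstants (littleConstants_of_bigConstants hc)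
  refine ⟨⟨zero_lt_one.trans_le (le_csInf hne h1), fun m n X => ?_⟩,
    fun c hc => csInf_le ⟨1, h1⟩ hc⟩
  exact csInf_mul_of_forall_le hne (normS_nonneg X) fun c hc => hc.2 m n X

end GrothendieckConstants

theorem mainTheorem1 :
    IsLeast GrothendieckConstants.littleConstants GrothendieckConstants.littleKG ∧
    IsLeast GrothendieckConstants.bigConstants GrothendieckConstants.bigKG ∧
    GrothendieckConstants.littleKG < 2 ∧
    GrothendieckConstants.littleKG ≤ GrothendieckConstants.bigKG ∧
    GrothendieckConstants.bigKG ≤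
      GrothendieckConstants.littleKG / (2 - GrothendieckConstants.littleKG) :=
  ⟨GrothendieckConstants.isLeast_littleConstants, GrothendieckConstants.isLeast_bigConstants,
    GrothendieckConstants.littleKG_lt_two,
    GrothendieckConstants.isLeast_littleConstants.2
      (GrothendieckConstants.littleConstants_of_bigConstants
        GrothendieckConstants.isLeast_bigConstants.1),
    GrothendieckConstants.isLeast_bigConstants.2
      GrothendieckConstants.littleKG_div_mem_bigConstants⟩
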